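/- Let $M\subseteq B(H)$ be a von Neumann algebra on a complex Hilbert space $H$, equipped with a faithful normal tracial state $\tau$ (a finite von Neumann algebra $(M,\tau)$). Let $m\ge 2$, let $k$ be an infinite field, let $\Gamma=PSL_m(k)$, and let $\varphi\colon\Gamma\to U(M)$ be a group homomorphism into the unitary group of $M$. Let $\lambda\colon\Gamma\to U(\ell^2\Gamma)$, $(\lambda(g)f)(h)=f(g^{-1}h)$, be the left regular representation, $L(\Gamma)=\lambda(\Gamma)''$ the group von Neumann algebra, and $\tau_\Gamma(x)=\langle x\delta_e,\delta_e\rangle$ its canonical trace. Then there exist a projection $p\in M$ commuting with $\varphi(g)$ for every $g\in\Gamma$ and a normal (i.e. ultraweakly continuous) $*$-homomorphism $\psi\colon L(\Gamma)\to pMp$ which is unital, $\psi(1)=p$, and trace-preserving with respect to the normalized trace of $pMp$, i.e. $$\tau(\psi(x))=\tau(p)\,\tau_\Gamma(x)\qquad\text{for all }x\in L(\Gamma),$$ such that $\psi$ is injective if $p\neq 0$, and $$\varphi(g)=\psi(\lambda(g))+(1-p)\qquad\text{for all }g\in\Gamma.$$ (The case $p=0$, $\psi=0$ occurs exactly when $\varphi$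 is trivial.) -/

import Mathlib

open scoped ComplexOrder

noncomputable section

namespace VNRigidity

universe u v

section VonNeumann

variable {H : Type u} [NormedAddCommGroup H] [InnerProductSpace ℂ H] [CompleteSpace H]
variable {K : Type v} [NormedAddCommGroup K] [InnerProductSpace ℂ K] [CompleteSpace K]

/-- The von Neumann algebra generated by a set `S` of bounded operators: the double commutant of
`S ∪ S*` (`StarSubalgebra.centralizer ℂ S` is the commutant of `S ∪ S*`). -/
def generatedBy (S : Set (H →L[ℂ] H)) : VonNeumannAlgebra H where
  toStarSubalgebra :=
    StarSubalgebra.centralizer ℂ (StarSubalgebra.centralizer ℂ S : Set (H →L[ℂ] H))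
  centralizer_centralizer' := by
    have h (T : StarSubalgebra ℂ (H →L[ℂ] H)) :
        (StarSubalgebra.centralizer ℂ (T : Set (H →L[ℂ] H))).carrier
          = Set.centralizer (T : Set (H →L[ℂ] H)) := by
      have hT : star (T : Set (H →L[ℂ] H)) = T := by
        ext x
        simp
      change ((StarSubalgebra.centralizer ℂ (T : Set (H →L[ℂ] H)) : StarSubalgebra ℂ (H →L[ℂ] H)) :
        Set (H →L[ℂ] H)) = _
      rw [StarSubalgebra.coe_centralizer, hT, Set.union_self]
    rw [h, Set.centralizer_centralizer_centralizer]

/-- A functional on a von Neumann algebra `M ⊆ B(H)` is normal if it is ultraweakly continuous,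
i.e. of the form `x ↦ ∑ₙ ⟨ξₙ, x ηₙ⟩` with `∑ ‖ξₙ‖² < ∞` and `∑ ‖ηₙ‖² < ∞`. -/
def IsNormalFunctional (M : VonNeumannAlgebra H) (f : M.toStarSubalgebra → ℂ) : Prop :=
  ∃ ξ η : ℕ → H, Summable (fun n => ‖ξ n‖ ^ 2) ∧ Summable (fun n => ‖η n‖ ^ 2) ∧
    ∀ x : M.toStarSubalgebra, HasSum (fun n => inner ℂ (ξ n) ((x : H →L[ℂ] H) (η n))) (f x)

/-- A map between von Neumann algebras is normal if it is continuous for the ultraweak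
topologies, i.e. it pulls normal functionals back to normal functionals. -/
def IsNormalMap (N : VonNeumannAlgebra K) (M : VonNeumannAlgebra H)
    (ψ : N.toStarSubalgebra → M.toStarSubalgebra) : Prop :=
  ∀ f : M.toStarSubalgebra → ℂ, IsNormalFunctional M f → IsNormalFunctional N (f ∘ ψ)

/-- `τ` is a faithful normal tracial state on `M`, i.e. `(M, τ)` is a finite von Neumann algebra
with its trace. -/
structure IsFaithfulNormalTrace (M : VonNeumannAlgebra H)
    (τ : M.toStarSubalgebra →ₗ[ℂ] ℂ) : Prop where
  map_one : τ 1 = 1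
  nonneg : ∀ x, 0 ≤ τ (star x * x)
  faithful : ∀ x, τ (star x * x) = 0 → x = 0
  tracial : ∀ x y, τ (x * y) = τ (y * x)
  normal : IsNormalFunctional M τ

/-- The corner `pMp`, for a projection `p` of `M`. -/
def corner (M : VonNeumannAlgebra H) (p : M.toStarSubalgebra) : Set M.toStarSubalgebra :=
  {y | ∃ x : M.toStarSubalgebra, y = p * x * p}

end VonNeumann

section GroupAlgebra

variable (Γ : Type u) [Group Γ]

/-- The Hilbert space `ℓ²(Γ)`. -/
abbrev EllTwo : Type u := lp (fun _ : Γ => ℂ) 2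

variable {Γ}

/-- Left translation `(λ(g) f)(h) = f(g⁻¹ h)` as a linear isometry of `ℓ²(Γ)`. -/
def leftTranslation (g : Γ) : EllTwo Γ →ₗᵢ[ℂ] EllTwo Γ where
  toFun f := ⟨fun h => f (g⁻¹ * h), by
    have hf := (memℓp_gen_iff (p := 2) (by norm_num)).1 (lp.memℓp f)
    exact (memℓp_gen_iff (p := 2) (by norm_num)).2
      ((Equiv.mulLeft g⁻¹).summable_iff.2 hf)⟩
  map_add' _ _ := rfl
  map_smul' _ _ := rfl
  norm_map' f := by
    have h2 : 0 < (2 : ENNReal).toReal := by norm_num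
    rw [lp.norm_eq_tsum_rpow h2, lp.norm_eq_tsum_rpow h2]
    congr 1
    exact (Equiv.mulLeft g⁻¹).tsum_eq (fun h => ‖f h‖ ^ (2 : ENNReal).toReal)

/-- The left regular representation `λ(g)`, as a bounded operator on `ℓ²(Γ)`. -/
def leftRegular (g : Γ) : EllTwo Γ →L[ℂ] EllTwo Γ := (leftTranslation g).toContinuousLinearMap

variable (Γ)

/-- The group von Neumann algebra `L(Γ) = λ(Γ)''`. -/
def groupVNA : VonNeumannAlgebra (EllTwo Γ) := generatedBy (Set.range (leftRegular (Γ := Γ)))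

variable {Γ}

theorem leftRegular_mem (g : Γ) : leftRegular g ∈ (groupVNA Γ).toStarSubalgebra := by
  change leftRegular g ∈ StarSubalgebra.centralizer ℂ _
  rw [StarSubalgebra.mem_centralizer_iff]
  intro x hx
  have hx' := (StarSubalgebra.mem_centralizer_iff ℂ).1 hx (leftRegular g) ⟨g, rfl⟩
  have hx'' := (StarSubalgebra.mem_centralizer_iff ℂ).1 (star_mem hx) (leftRegular g) ⟨g, rfl⟩
  exact ⟨hx'.1.symm, hx''.1.symm⟩

/-- `λ(g)` as an element of `L(Γ)`. -/
def lam (g : Γ) : (groupVNA Γ).toStarSubalgebra := ⟨leftRegular g, leftRegular_mem g⟩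

open Classical in
/-- The canonical trace `x ↦ ⟨x δ_e, δ_e⟩` of `L(Γ)`. -/
def groupTrace (x : (groupVNA Γ).toStarSubalgebra) : ℂ :=
  inner ℂ (lp.single 2 (1 : Γ) (1 : ℂ) : EllTwo Γ)
    ((x : EllTwo Γ →L[ℂ] EllTwo Γ) (lp.single 2 (1 : Γ) (1 : ℂ)))

end GroupAlgebra

end VNRigidity

end

/-! Let `R = fixP φ` be the projection onto the `φ`-fixed vectors. It lies in `M`, and the theorem
holds with `p = 1 - R`. The proof has two halves: the character `τ ∘ φ` equals `τ R` away from the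
identity, and a corner whose character is a multiple of `δ_e` extends to `L(Γ)`.

Character rigidity rests on two tools. By a mean ergodic argument the trace of a fixed-point
projection times an element is determined by the coefficients off the identity (`trace_fixP_eq`). By
finiteness, infinitely many orthogonal elements of bounded `τ`-norm cannot have the same nonzero
product with a given element (`eq_zero_of_orthogonal`). For `SL₂(k)` they show that vectors fixed by
the upper unipotents are fixed by the whole group (`fixP_upper_eq`), and hence that the character is
constant off the Borel subgroup. For `SLₙ(k)`, opposite transvection groups span copies of `SL₂(k)`
and any two transvection groups have a common opposite, so each has fixed-point projection `R`. A
noncentral `g` has infinitely many conjugates by transvections whose quotients lie, up to conjugacy,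
in such a copy; this gives `τ(φ g) = τ R` (`trace_eq_of_notMem_center`).

Thus `τ(φ(g) p) = 0` for `g ≠ 1`, and the elements `φ(g) p` are orthogonal for `τ`. The coefficients
of `x` along them give a bounded intertwiner from an amplification of `H` to `ℓ²Γ`
(`exists_coefficientOperator`). Consequently intertwiners separate the points of `pH`, and a maximal
orthogonal family of partially isometric ones assembles to `T : H → ⊕ ℓ²Γ` with `T†T = p`
(`exists_regular_embedding`). The homomorphism is `ψ(x) = T†(x ⊗ 1)T`. -/

noncomputable section

namespace VNRigidity

open scoped InnerProductSpace

/-! ### Diagonal operators on `ℓ²`-sums. -/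

section DiagonalOperators

variable {ι E F : Type*} [NormedAddCommGroup E] [NormedAddCommGroup F]

theorem summable_sq_of_lp (f : lp (fun _ : ι => E) 2) : Summable fun i => ‖f i‖ ^ 2 := by
  have h := (memℓp_gen_iff (p := 2) (by norm_num)).1 (lp.memℓp f)
  simpa using h

theorem memℓp_two_of_summable {f : ι → E} (h : Summable fun i => ‖f i‖ ^ 2) : Memℓp f 2 :=
  memℓp_gen (by simpa using h)

theorem lp_norm_sq_eq_tsum (f : lp (fun _ : ι => E) 2) : ‖f‖ ^ 2 = ∑' i, ‖f i‖ ^ 2 := by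
  have h := lp.norm_rpow_eq_tsum (p := 2) (by norm_num) f
  simpa using h

/-- A square-summable family as an element of `ℓ²`. -/
def toLp (f : ι → E) (h : Summable fun i => ‖f i‖ ^ 2) : lp (fun _ : ι => E) 2 :=
  ⟨f, memℓp_two_of_summable h⟩

@[simp]
theorem toLp_apply (f : ι → E) (h : Summable fun i => ‖f i‖ ^ 2) (i : ι) : toLp f h i = f i := rfl

variable [InnerProductSpace ℂ E] [InnerProductSpace ℂ F]

theorem summable_sq_map {T : ι → E →L[ℂ] F} {C : ℝ} (hT : ∀ i, ‖T i‖ ≤ C)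
    {f : ι → E} (hf : Summable fun i => ‖f i‖ ^ 2) : Summable fun i => ‖T i (f i)‖ ^ 2 := by
  refine Summable.of_nonneg_of_le (fun i => by positivity) (fun i => ?_) (hf.mul_left (C ^ 2))
  rw [← mul_pow]
  gcongr
  exact (T i).le_of_opNorm_le (hT i) (f i)

/-- The diagonal operator between `ℓ²`-sums given by a uniformly bounded family of operators. -/
def diagOp (T : ι → E →L[ℂ] F) (C : ℝ) (hT : ∀ i, ‖T i‖ ≤ C) :
    lp (fun _ : ι => E) 2 →L[ℂ] lp (fun _ : ι => F) 2 :=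
  LinearMap.mkContinuous
    { toFun := fun f => toLp (fun i => T i (f i)) (summable_sq_map hT (summable_sq_of_lp f))
      map_add' := fun f g => by
        refine lp.ext (funext fun i => ?_)
        simp
      map_smul' := fun c f => by
        refine lp.ext (funext fun i => ?_)
        simp } |C| (fun f => by
      refine (sq_le_sq₀ (norm_nonneg _) (by positivity)).1 ?_
      rw [lp_norm_sq_eq_tsum, mul_pow, lp_norm_sq_eq_tsum, ← tsum_mul_left]
      refine Summable.tsum_le_tsum (fun i => ?_) (summable_sq_map hT (summable_sq_of_lp f))
        ((summable_sq_of_lp f).mul_left _)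
      rw [← mul_pow]
      have := (T i).le_of_opNorm_le ((hT i).trans (le_abs_self C)) (f i)
      change ‖T i (f i)‖ ^ 2 ≤ _
      gcongr)

@[simp]
theorem diagOp_apply (T : ι → E →L[ℂ] F) (C : ℝ) (hT : ∀ i, ‖T i‖ ≤ C)
    (f : lp (fun _ : ι => E) 2) (i : ι) : diagOp T C hT f i = T i (f i) := rfl

variable (ι) in
/-- The amplification `T ⊗ 1` of an operator to `ℓ²`-sums. -/
def amp (T : E →L[ℂ] F) : lp (fun _ : ι => E) 2 →L[ℂ] lp (fun _ : ι => F) 2 :=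
  diagOp (fun _ => T) ‖T‖ (fun _ => le_rfl)

@[simp]
theorem amp_apply (T : E →L[ℂ] F) (f : lp (fun _ : ι => E) 2) (i : ι) : amp ι T f i = T (f i) :=
  rfl

end DiagonalOperators

/-! ### A mean ergodic argument. -/

section MeanErgodic

variable {Λ K : Type*} [Group Λ] [NormedAddCommGroup K] [InnerProductSpace ℂ K] [CompleteSpace K]

/-- If a matrix coefficient of a unitary representation of an infinite group vanishes away from
the identity, then its mean value vanishes. -/
theorem inner_fixed_eq_zero [Infinite Λ] (π : Λ → K →L[ℂ] K) (hone : π 1 = 1)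
    (hmul : ∀ g h, π (g * h) = π g * π h) (hiso : ∀ g u v, ⟪π g u, π g v⟫_ℂ = ⟪u, v⟫_ℂ)
    {ξ η η₀ : K} (hfix : ∀ g, π g η₀ = η₀)
    (horth : ∀ w, (∀ g, π g w = w) → ⟪w, η - η₀⟫_ℂ = 0)
    (h : ∀ g, g ≠ 1 → ⟪ξ, π g η⟫_ℂ = 0) : ⟪ξ, η₀⟫_ℂ = 0 := by
  have hinv : ∀ g u, π g⁻¹ (π g u) = u := fun g u => by
    have := congrArg (fun T : K →L[ℂ] K => T u) (hmul g⁻¹ g)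
    simpa [hone] using this.symm
  have hadj : ∀ g u v, ⟪π g u, v⟫_ℂ = ⟪u, π g⁻¹ v⟫_ℂ := fun g u v => by
    rw [← hiso g⁻¹ (π g u) v, hinv]
  let W : Submodule ℂ K := (Submodule.span ℂ (Set.range fun g => π g η)).topologicalClosure
  have hWc : IsClosed (W : Set K) := Submodule.isClosed_topologicalClosure _
  have : CompleteSpace W := hWc.completeSpace_coe
  have hmemW : ∀ g, π g η ∈ W := fun g =>
    Submodule.le_topologicalClosure _ (Submodule.subset_span ⟨g, rfl⟩)
  have hηW : η ∈ W := by simpa [hone] using hmemW 1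
  have hWinv : ∀ g, ∀ w ∈ W, π g w ∈ W := by
    intro g
    have : W ≤ W.comap (π g).toLinearMap := by
      refine Submodule.topologicalClosure_minimal _ (Submodule.span_le.2 ?_)
        (hWc.preimage (π g).continuous)
      rintro _ ⟨k, rfl⟩
      change π g (π k η) ∈ W
      have := hmemW (g * k)
      rwa [hmul] at this
    exact this
  -- `W` is invariant, so `q` is fixed. Then `η₀ - q` is a fixed vector orthogonal to `W`, in
  -- particular to `η`, and `horth` forces it to vanish. Hence `η₀` is a limit of combinations of
  -- translates of `η`.
  set q : K := W.starProjection η₀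
  have hqW : q ∈ W := Submodule.starProjection_apply_mem _ _
  have hqo : ∀ w ∈ W, ⟪w, η₀ - q⟫_ℂ = 0 := fun w hw =>
    (Submodule.mem_orthogonal _ _).1 (Submodule.sub_starProjection_mem_orthogonal η₀) w hw
  have hdfix : ∀ g, π g (η₀ - q) = η₀ - q := by
    intro g
    have h1 : π g q = q := by
      refine Submodule.eq_starProjection_of_mem_orthogonal (hWinv g q hqW) ?_ |>.symm
      rw [Submodule.mem_orthogonal]
      intro w hw
      have h2 := hqo _ (hWinv g⁻¹ w hw)
      rw [hadj, inv_inv, map_sub, hfix] at h2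
      exact h2
    rw [map_sub, hfix, h1]
  have hη₀ : η₀ ∈ W := by
    have h1 := horth _ hdfix
    have h2 : ⟪η₀ - q, η⟫_ℂ = 0 := by
      rw [← inner_conj_symm, hqo η hηW, map_zero]
    have h3 : ⟪η₀ - q, q⟫_ℂ = 0 := by
      rw [← inner_conj_symm, hqo q hqW, map_zero]
    have h4 : ⟪η₀ - q, η₀ - q⟫_ℂ = 0 := by
      rw [inner_sub_right] at h1
      rw [inner_sub_right]
      rw [h2] at h1
      rw [h3]
      linear_combination -h1
    rw [inner_self_eq_zero, sub_eq_zero] at h4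
    rw [h4]
    exact hqW
  have hspan : ∀ v ∈ Submodule.span ℂ (Set.range fun g => π g η),
      ∃ s : Finset Λ, ∀ g ∉ s, ⟪π g ξ, v⟫_ℂ = 0 := by
    classical
    intro v hv
    induction hv using Submodule.span_induction with
    | mem x hx =>
      obtain ⟨k, rfl⟩ := hx
      refine ⟨{k}, fun g hg => ?_⟩
      have h1 : g⁻¹ * k ≠ 1 := by
        intro h2
        exact hg (by simpa using inv_mul_eq_one.1 h2)
      have h2 := h _ h1
      rw [hmul] at h2
      rw [hadj]
      exact h2
    | zero => exact ⟨∅, by simp⟩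
    | add x y _ _ hx hy =>
      obtain ⟨s, hs⟩ := hx
      obtain ⟨t, ht⟩ := hy
      refine ⟨s ∪ t, fun g hg => ?_⟩
      rw [Finset.notMem_union] at hg
      rw [inner_add_right, hs g hg.1, ht g hg.2, add_zero]
    | smul c x _ hx =>
      obtain ⟨s, hs⟩ := hx
      refine ⟨s, fun g hg => ?_⟩
      rw [inner_smul_right, hs g hg, mul_zero]
  have hnorm : ∀ g u, ‖π g u‖ = ‖u‖ := fun g u => by
    have h1 := hiso g u u
    rw [inner_self_eq_norm_sq_to_K, inner_self_eq_norm_sq_to_K] at h1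
    have h2 : ‖π g u‖ ^ 2 = ‖u‖ ^ 2 := by exact_mod_cast h1
    exact (sq_eq_sq₀ (norm_nonneg _) (norm_nonneg _)).1 h2
  -- Replacing `ξ` by `π g ξ` does not change its product with the fixed vector `η₀`. For `g`
  -- outside a finite set it kills the product with the finite combination `v` approximating `η₀`.
  have hbound : ∀ ε > 0, ‖⟪ξ, η₀⟫_ℂ‖ ≤ ‖ξ‖ * ε := by
    intro ε hε
    obtain ⟨v, hv, hvε⟩ := Metric.mem_closure_iff.1
      (show η₀ ∈ closure (Submodule.span ℂ (Set.range fun g => π g η) : Set K) from hη₀) ε hε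
    obtain ⟨s, hs⟩ := hspan v hv
    obtain ⟨g, hg⟩ := Infinite.exists_notMem_finset s
    have h1 : ⟪ξ, η₀⟫_ℂ = ⟪π g ξ, η₀ - v⟫_ℂ := by
      rw [inner_sub_right, hs g hg, sub_zero, hadj, hfix]
    rw [h1]
    refine (norm_inner_le_norm _ _).trans ?_
    rw [hnorm, ← dist_eq_norm]
    gcongr
  have : ‖⟪ξ, η₀⟫_ℂ‖ ≤ 0 := by
    refine le_of_forall_pos_le_add fun ε hε => ?_
    refine (hbound (ε / (‖ξ‖ + 1)) (by positivity)).trans ?_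
    rw [zero_add, mul_div_assoc', div_le_iff₀ (by positivity)]
    nlinarith [norm_nonneg ξ]
  exact norm_le_zero_iff.1 this

end MeanErgodic

/-! ### Fixed-point projections of unitary representations in `M`. -/

section FixedProjection

variable {H : Type*} [NormedAddCommGroup H] [InnerProductSpace ℂ H] [CompleteSpace H]
  {M : VonNeumannAlgebra H}

theorem mem_of_commute_commutant {T : H →L[ℂ] H} (h : ∀ y ∈ M.commutant, y * T = T * y) :
    T ∈ M.toStarSubalgebra := by
  have : T ∈ M.commutant.commutant := VonNeumannAlgebra.mem_commutant_iff.2 h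
  rw [VonNeumannAlgebra.commutant_commutant] at this
  exact this

theorem commutant_apply {y : H →L[ℂ] H} (hy : y ∈ M.commutant) (x : M.toStarSubalgebra) (v : H) :
    (x : H →L[ℂ] H) (y v) = y ((x : H →L[ℂ] H) v) := by
  have := VonNeumannAlgebra.mem_commutant_iff.1 hy x x.2
  exact congrArg (fun T : H →L[ℂ] H => T v) this

/-- By the bicommutant theorem, a projection lies in `M` as soon as its range is invariant under
`M'`. -/
theorem starProjection_mem (K : Submodule ℂ H) [K.HasOrthogonalProjection]
    (h : ∀ y ∈ M.commutant, ∀ v ∈ K, y v ∈ K) : K.starProjection ∈ M.toStarSubalgebra := by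
  refine (VonNeumannAlgebra.IsStarProjection.mem_iff isStarProjection_starProjection M).2 ?_
  intro y hy
  rw [Module.End.mem_invtSubmodule]
  intro v hv
  rw [Submodule.range_starProjection] at hv
  rw [Submodule.mem_comap, Submodule.range_starProjection]
  exact h y hy v hv

variable {Λ Λ' : Type*} [Group Λ'] [Group Λ]

/-- The operator on `H` by which `g` acts. -/
abbrev uop (ρ : Λ →* unitary M.toStarSubalgebra) (g : Λ) : M.toStarSubalgebra := ρ g

theorem uop_mul (ρ : Λ →* unitary M.toStarSubalgebra) (g h : Λ) :
    uop ρ (g * h) = uop ρ g * uop ρ h := by simp [uop]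

theorem uop_one (ρ : Λ →* unitary M.toStarSubalgebra) : uop ρ 1 = 1 := by simp [uop]

theorem uop_inv (ρ : Λ →* unitary M.toStarSubalgebra) (g : Λ) :
    uop ρ g⁻¹ = star (uop ρ g) := by
  simp [uop, ← Unitary.star_eq_inv]

/-- The space of vectors fixed by a unitary representation in `M`. -/
def fixedSpace (ρ : Λ →* unitary M.toStarSubalgebra) : Submodule ℂ H where
  carrier := {v | ∀ g, (uop ρ g : H →L[ℂ] H) v = v}
  add_mem' hv hw g := by rw [map_add, hv g, hw g]
  zero_mem' g := map_zero _
  smul_mem' c v hv g := by rw [map_smul, hv g]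

theorem mem_fixedSpace {ρ : Λ →* unitary M.toStarSubalgebra} {v : H} :
    v ∈ fixedSpace ρ ↔ ∀ g, (uop ρ g : H →L[ℂ] H) v = v := Iff.rfl

theorem isClosed_fixedSpace (ρ : Λ →* unitary M.toStarSubalgebra) :
    IsClosed (fixedSpace ρ : Set H) := by
  have : (fixedSpace ρ : Set H) = ⋂ g, {v | (uop ρ g : H →L[ℂ] H) v = v} := by
    ext v
    simp [mem_fixedSpace]
  rw [this]
  exact isClosed_iInter fun g => isClosed_eq (uop ρ g : H →L[ℂ] H).continuous continuous_id

instance (ρ : Λ →* unitary M.toStarSubalgebra) : CompleteSpace (fixedSpace ρ) :=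
  (isClosed_fixedSpace ρ).completeSpace_coe

/-- The projection onto the fixed vectors of a unitary representation in `M`, an element of `M`. -/
def fixP (ρ : Λ →* unitary M.toStarSubalgebra) : M.toStarSubalgebra :=
  ⟨(fixedSpace ρ).starProjection, starProjection_mem _ fun y hy v hv g => by
    rw [commutant_apply hy, hv g]⟩

theorem isStarProjection_fixP (ρ : Λ →* unitary M.toStarSubalgebra) :
    IsStarProjection (fixP ρ) := by
  have h : IsStarProjection (fixedSpace ρ).starProjection := isStarProjection_starProjection
  exact ⟨Subtype.ext h.1, Subtype.ext h.2⟩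

theorem fixP_mul_self (ρ : Λ →* unitary M.toStarSubalgebra) : fixP ρ * fixP ρ = fixP ρ :=
  (isStarProjection_fixP ρ).1

theorem star_fixP (ρ : Λ →* unitary M.toStarSubalgebra) : star (fixP ρ) = fixP ρ :=
  (isStarProjection_fixP ρ).2

theorem uop_mul_fixP (ρ : Λ →* unitary M.toStarSubalgebra) (g : Λ) :
    uop ρ g * fixP ρ = fixP ρ := by
  refine Subtype.ext (ContinuousLinearMap.ext fun v => ?_)
  exact Submodule.starProjection_apply_mem (fixedSpace ρ) v g

theorem fixP_mul_uop (ρ : Λ →* unitary M.toStarSubalgebra) (g : Λ) :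
    fixP ρ * uop ρ g = fixP ρ := by
  have h := congrArg star (uop_mul_fixP ρ g⁻¹)
  rwa [star_mul, star_fixP, uop_inv, star_star] at h

theorem fixP_mul_eq {ρ : Λ →* unitary M.toStarSubalgebra} {x : M.toStarSubalgebra}
    (h : ∀ g, uop ρ g * x = x) : fixP ρ * x = x := by
  refine Subtype.ext (ContinuousLinearMap.ext fun v => ?_)
  refine Submodule.starProjection_eq_self_iff.2 fun g => ?_
  exact congrArg (fun T : M.toStarSubalgebra => (T : H →L[ℂ] H) v) (h g)

theorem mul_fixP_eq {ρ : Λ →* unitary M.toStarSubalgebra} {x : M.toStarSubalgebra}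
    (h : ∀ g, x * uop ρ g = x) : x * fixP ρ = x := by
  have h1 : fixP ρ * star x = star x := fixP_mul_eq fun g => by
    have := congrArg star (h g⁻¹)
    rwa [star_mul, uop_inv, star_star] at this
  simpa [star_fixP] using congrArg star h1

/-- Two representations, the elements of which are conjugate under `w`, have conjugate fixed-point
projections. -/
theorem mul_fixP_eq_fixP_mul {ρ : Λ →* unitary M.toStarSubalgebra}
    {ρ' : Λ' →* unitary M.toStarSubalgebra} {w : M.toStarSubalgebra}
    (h : ∀ g, ∃ g', uop ρ g * w = w * uop ρ' g') (h' : ∀ g', ∃ g, w * uop ρ' g' = uop ρ g * w) :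
    fixP ρ * w = w * fixP ρ' := by
  have h1 : fixP ρ * (w * fixP ρ') = w * fixP ρ' := fixP_mul_eq fun g => by
    obtain ⟨g', hg'⟩ := h g
    rw [← mul_assoc, hg', mul_assoc, uop_mul_fixP]
  have h2 : (fixP ρ * w) * fixP ρ' = fixP ρ * w := mul_fixP_eq fun g' => by
    obtain ⟨g, hg⟩ := h' g'
    rw [mul_assoc, hg, ← mul_assoc, fixP_mul_uop]
  rw [← h2, mul_assoc, h1]

theorem fixP_congr {ρ : Λ →* unitary M.toStarSubalgebra} {ρ' : Λ' →* unitary M.toStarSubalgebra}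
    (h : ∀ g, ∃ g', uop ρ g = uop ρ' g') (h' : ∀ g', ∃ g, uop ρ' g' = uop ρ g) :
    fixP ρ = fixP ρ' := by
  have := mul_fixP_eq_fixP_mul (ρ := ρ) (ρ' := ρ') (w := 1) (by simpa using h) (by simpa using h')
  simpa using this

theorem fixP_one : fixP (1 : Λ →* unitary M.toStarSubalgebra) = 1 := by
  have h := fixP_mul_eq (ρ := (1 : Λ →* unitary M.toStarSubalgebra)) (x := 1)
    (fun g => by simp [uop])
  simpa using h

theorem inner_uop (ρ : Λ →* unitary M.toStarSubalgebra) (g : Λ) (u v : H) :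
    ⟪(uop ρ g : H →L[ℂ] H) u, (uop ρ g : H →L[ℂ] H) v⟫_ℂ = ⟪u, v⟫_ℂ := by
  rw [← ContinuousLinearMap.adjoint_inner_right]
  congr 1
  have h : star (uop ρ g) * uop ρ g = 1 := Unitary.coe_star_mul_self (ρ g)
  exact congrArg (fun T : M.toStarSubalgebra => (T : H →L[ℂ] H) v) h

theorem inner_sub_fixP {ρ : Λ →* unitary M.toStarSubalgebra} {w : H} (hw : w ∈ fixedSpace ρ)
    (v : H) : ⟪w, v - (fixP ρ : H →L[ℂ] H) v⟫_ℂ = 0 :=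
  (Submodule.mem_orthogonal _ _).1 (Submodule.sub_starProjection_mem_orthogonal v) w hw

theorem norm_uop_le (ρ : Λ →* unitary M.toStarSubalgebra) (g : Λ) :
    ‖(uop ρ g : H →L[ℂ] H)‖ ≤ 1 := by
  refine ContinuousLinearMap.opNorm_le_bound _ zero_le_one fun v => ?_
  have h := inner_uop ρ g v v
  rw [inner_self_eq_norm_sq_to_K, inner_self_eq_norm_sq_to_K] at h
  have h2 : ‖(uop ρ g : H →L[ℂ] H) v‖ ^ 2 = ‖v‖ ^ 2 := by exact_mod_cast h
  rw [one_mul]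
  exact ((sq_eq_sq₀ (norm_nonneg _) (norm_nonneg _)).1 h2).le

end FixedProjection

/-! ### Traces: mean values and finiteness. -/

section Trace

variable {H : Type*} [NormedAddCommGroup H] [InnerProductSpace ℂ H] [CompleteSpace H]
  {M : VonNeumannAlgebra H} {τ : M.toStarSubalgebra →ₗ[ℂ] ℂ}

namespace IsFaithfulNormalTrace

/-- Positivity is used at `x`, `x + 1` and `x + i`: the imaginary parts of the mixed terms must
vanish. -/
theorem map_star (hτ : IsFaithfulNormalTrace M τ) (x : M.toStarSubalgebra) :
    τ (star x) = star (τ x) := by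
  have im0 : ∀ y, (τ (star y * y)).im = 0 := fun y => (Complex.nonneg_iff.1 (hτ.nonneg y)).2.symm
  have h1 := im0 (x + 1)
  have h2 := im0 (x + Complex.I • 1)
  have h0 := im0 x
  have h11 := im0 1
  have e1 : star (x + 1) * (x + 1) = star x * x + star x + x + star 1 * 1 := by
    rw [star_add, star_one]
    noncomm_ring
  have e2 : star (x + Complex.I • (1 : M.toStarSubalgebra)) * (x + Complex.I • 1)
      = star x * x + Complex.I • star x - Complex.I • x + star 1 * 1 := by
    have hI : Complex.I • Complex.I • (1 : M.toStarSubalgebra) = -1 := by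
      rw [smul_smul, Complex.I_mul_I, neg_one_smul]
    rw [star_add, star_smul, star_one]
    simp only [RCLike.star_def, Complex.conj_I, add_mul, mul_add, neg_smul, neg_mul, smul_mul_assoc,
      one_mul, mul_smul_comm, mul_one, smul_add, smul_neg, hI]
    abel
  rw [e1, _root_.map_add, _root_.map_add, _root_.map_add] at h1
  rw [e2, _root_.map_add, _root_.map_sub, _root_.map_add, _root_.map_smul, _root_.map_smul] at h2
  simp only [Complex.add_im, Complex.sub_im, smul_eq_mul, Complex.mul_im, Complex.I_re,
    Complex.I_im] at h1 h2
  apply Complex.ext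
  · simp
    linarith
  · simp
    linarith

/-- The positive semidefinite inner product `⟨x, y⟩ = τ(x* y)`. -/
@[reducible]
def core (hτ : IsFaithfulNormalTrace M τ) : PreInnerProductSpace.Core ℂ M.toStarSubalgebra where
  inner x y := τ (star x * y)
  conj_inner_symm x y := by
    change star (τ (star y * x)) = τ (star x * y)
    rw [← hτ.map_star, star_mul, star_star]
  re_inner_nonneg x := (Complex.nonneg_iff.1 (hτ.nonneg x)).1
  add_left x y z := by rw [star_add, add_mul, _root_.map_add]
  smul_left x y r := by
    rw [star_smul, smul_mul_assoc, _root_.map_smul]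
    rfl

theorem norm_sq_le (hτ : IsFaithfulNormalTrace M τ) (x y : M.toStarSubalgebra) :
    ‖τ (star x * y)‖ ^ 2 ≤ (τ (star x * x)).re * (τ (star y * y)).re := by
  have h := @InnerProductSpace.Core.inner_mul_inner_self_le ℂ M.toStarSubalgebra _ _ _ hτ.core x y
  have e : τ (star y * x) = star (τ (star x * y)) := by
    rw [← hτ.map_star, star_mul, star_star]
  change ‖τ (star x * y)‖ * ‖τ (star y * x)‖ ≤ (τ (star x * x)).re * (τ (star y * y)).re at h
  rwa [e, norm_star, ← sq] at h

theorem eq_zero_of_forall (hτ : IsFaithfulNormalTrace M τ) {x : M.toStarSubalgebra}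
    (h : ∀ y, τ (x * y) = 0) : x = 0 := by
  apply hτ.faithful
  rw [hτ.tracial]
  exact h _

/-- A Bessel-type argument: an element cannot have the same nonzero inner product with infinitely
many pairwise orthogonal elements of bounded norm. -/
theorem eq_zero_of_orthogonal (hτ : IsFaithfulNormalTrace M τ) {I : Type*} [Infinite I]
    {x : I → M.toStarSubalgebra} {y : M.toStarSubalgebra} {c : ℂ} {K : ℝ}
    (horth : ∀ i j, i ≠ j → τ (star (x i) * x j) = 0)
    (hK : ∀ i, (τ (star (x i) * x i)).re ≤ K) (hc : ∀ i, τ (star y * x i) = c) : c = 0 := by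
  classical
  by_contra hne
  have hcpos : 0 < ‖c‖ ^ 2 := by positivity
  set B := (τ (star y * y)).re
  have hB : 0 ≤ B := (Complex.nonneg_iff.1 (hτ.nonneg y)).1
  -- For a sum of `N` of the `x i`, Cauchy–Schwarz reads `N²‖c‖² ≤ B·N·K`, which fails once `N >
  -- BK/‖c‖²`.
  obtain ⟨n, hn⟩ := exists_nat_gt (B * K / ‖c‖ ^ 2)
  obtain ⟨s, hs⟩ := Infinite.exists_subset_card_eq I (n + 1)
  have h := hτ.norm_sq_le y (∑ i ∈ s, x i)
  rw [Finset.mul_sum, map_sum, Finset.sum_congr rfl (fun i _ => hc i), Finset.sum_const,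
    nsmul_eq_mul, norm_mul, mul_pow, Complex.norm_natCast, hs] at h
  have h2 : (τ (star (∑ i ∈ s, x i) * ∑ i ∈ s, x i)).re ≤ (n + 1 : ℕ) * K := by
    rw [star_sum, Finset.sum_mul_sum, map_sum, Complex.re_sum]
    have : ∀ i ∈ s, (τ (∑ j ∈ s, star (x i) * x j)).re ≤ K := fun i hi => by
      rw [map_sum, Finset.sum_eq_single i (fun j _ hj => horth i j hj.symm)
        (fun h => absurd hi h)]
      exact hK i
    refine (Finset.sum_le_sum this).trans ?_
    rw [Finset.sum_const, hs, nsmul_eq_mul]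
  have h3 : ((n + 1 : ℕ) : ℝ) ^ 2 * ‖c‖ ^ 2 ≤ B * ((n + 1 : ℕ) * K) :=
    h.trans (mul_le_mul_of_nonneg_left h2 hB)
  have hpos : (0 : ℝ) < ((n + 1 : ℕ) : ℝ) := by positivity
  have h4 : ((n + 1 : ℕ) : ℝ) * ‖c‖ ^ 2 ≤ B * K := by
    refine le_of_mul_le_mul_left ?_ hpos
    nlinarith
  rw [div_lt_iff₀ hcpos] at hn
  push_cast at h4
  nlinarith

variable {Λ : Type*} [Group Λ] [Infinite Λ]

/-- Mean values of coefficient functions `g ↦ τ(ρ(g) x)` are determined by the functions away from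
the identity. -/
theorem trace_fixP_eq (hτ : IsFaithfulNormalTrace M τ) (ρ₁ ρ₂ : Λ →* unitary M.toStarSubalgebra)
    {x₁ x₂ : M.toStarSubalgebra}
    (h : ∀ g, g ≠ 1 → τ (uop ρ₁ g * x₁) = τ (uop ρ₂ g * x₂)) :
    τ (fixP ρ₁ * x₁) = τ (fixP ρ₂ * x₂) := by
  obtain ⟨ξ, η, hξ, hη, hsum⟩ := hτ.normal
  -- Both representations act on one `ℓ²`-sum of copies of `H`. The sign in `ξ'` turns the
  -- difference `τ y₁ - τ y₂` into a single matrix coefficient, to which `inner_fixed_eq_zero`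
  -- applies.
  let ρ : ℕ ⊕ ℕ → Λ →* unitary M.toStarSubalgebra := Sum.elim (fun _ => ρ₁) (fun _ => ρ₂)
  let π : Λ → lp (fun _ : ℕ ⊕ ℕ => H) 2 →L[ℂ] lp (fun _ : ℕ ⊕ ℕ => H) 2 := fun g =>
    diagOp (fun i => (uop (ρ i) g : H →L[ℂ] H)) 1 (fun i => norm_uop_le _ _)
  have hsq : ∀ x : M.toStarSubalgebra, Summable fun n => ‖(x : H →L[ℂ] H) (η n)‖ ^ 2 := fun x =>
    summable_sq_map (T := fun _ => (x : H →L[ℂ] H)) (fun _ => le_rfl) hη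
  have hsq2 : ∀ y₁ y₂ : M.toStarSubalgebra, Summable fun i : ℕ ⊕ ℕ =>
      ‖Sum.elim (fun n => (y₁ : H →L[ℂ] H) (η n)) (fun n => (y₂ : H →L[ℂ] H) (η n)) i‖ ^ 2 := by
    intro y₁ y₂
    exact (HasSum.sum (f := fun i : ℕ ⊕ ℕ => ‖Sum.elim (fun n => (y₁ : H →L[ℂ] H) (η n))
      (fun n => (y₂ : H →L[ℂ] H) (η n)) i‖ ^ 2) (hsq y₁).hasSum (hsq y₂).hasSum).summable
  let ξ' : lp (fun _ : ℕ ⊕ ℕ => H) 2 := toLp (Sum.elim ξ (fun n => - ξ n)) (by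
    exact (HasSum.sum (f := fun i : ℕ ⊕ ℕ => ‖Sum.elim ξ (fun n => - ξ n) i‖ ^ 2) hξ.hasSum
      (by simpa [Function.comp_def] using hξ.hasSum)).summable)
  let V : M.toStarSubalgebra → M.toStarSubalgebra → lp (fun _ : ℕ ⊕ ℕ => H) 2 := fun y₁ y₂ =>
    toLp (Sum.elim (fun n => (y₁ : H →L[ℂ] H) (η n)) (fun n => (y₂ : H →L[ℂ] H) (η n))) (hsq2 y₁ y₂)
  have hinner : ∀ y₁ y₂, ⟪ξ', V y₁ y₂⟫_ℂ = τ y₁ - τ y₂ := by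
    intro y₁ y₂
    refine (lp.hasSum_inner ξ' (V y₁ y₂)).unique ?_
    rw [sub_eq_add_neg]
    refine HasSum.sum (f := fun i => ⟪ξ' i, V y₁ y₂ i⟫_ℂ) (hsum y₁) ?_
    have := (hsum y₂).neg
    simpa [Function.comp_def, ξ', V] using this
  have key := inner_fixed_eq_zero π (ξ := ξ') (η := V x₁ x₂) (η₀ := V (fixP ρ₁ * x₁) (fixP ρ₂ * x₂))
    ?_ ?_ ?_ ?_ ?_ ?_
  · rw [hinner, sub_eq_zero] at key
    exact key
  · refine ContinuousLinearMap.ext fun f => lp.ext (funext fun i => ?_)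
    exact congrArg (fun T : M.toStarSubalgebra => (T : H →L[ℂ] H) (f i)) (uop_one (ρ i))
  · intro g k
    refine ContinuousLinearMap.ext fun f => lp.ext (funext fun i => ?_)
    exact congrArg (fun T : M.toStarSubalgebra => (T : H →L[ℂ] H) (f i)) (uop_mul (ρ i) g k)
  · intro g u v
    rw [lp.inner_eq_tsum, lp.inner_eq_tsum]
    exact tsum_congr fun i => inner_uop _ _ _ _
  · intro g
    refine lp.ext (funext fun i => ?_)
    rcases i with n | n
    · exact congrArg (fun T : M.toStarSubalgebra => (T : H →L[ℂ] H) (η n))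
        (show uop ρ₁ g * (fixP ρ₁ * x₁) = fixP ρ₁ * x₁ by rw [← mul_assoc, uop_mul_fixP])
    · exact congrArg (fun T : M.toStarSubalgebra => (T : H →L[ℂ] H) (η n))
        (show uop ρ₂ g * (fixP ρ₂ * x₂) = fixP ρ₂ * x₂ by rw [← mul_assoc, uop_mul_fixP])
  · intro w hw
    have hw' : ∀ i, w i ∈ fixedSpace (ρ i) := fun i g =>
      congrArg (fun f : lp (fun _ : ℕ ⊕ ℕ => H) 2 => f i) (hw g)
    rw [lp.inner_eq_tsum]
    refine (tsum_congr fun i => ?_).trans tsum_zero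
    rcases i with n | n
    · exact inner_sub_fixP (hw' (Sum.inl n)) _
    · exact inner_sub_fixP (hw' (Sum.inr n)) _
  · intro g hg
    have : π g (V x₁ x₂) = V (uop ρ₁ g * x₁) (uop ρ₂ g * x₂) := by
      refine lp.ext (funext fun i => ?_)
      rcases i with n | n <;> rfl
    rw [this, hinner, h g hg, sub_self]

theorem trace_fixP_eq_const (hτ : IsFaithfulNormalTrace M τ) (ρ : Λ →* unitary M.toStarSubalgebra)
    {x : M.toStarSubalgebra} {c : ℂ} (h : ∀ g, g ≠ 1 → τ (uop ρ g * x) = c) :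
    τ (fixP ρ * x) = c := by
  have := hτ.trace_fixP_eq ρ 1 (x₁ := x) (x₂ := c • 1) fun g hg => by
    rw [h g hg]
    simp [uop, hτ.map_one]
  rw [this, fixP_one]
  simp [hτ.map_one]

/-- Finiteness: if the ranges of `ρ(g) X` are pairwise orthogonal for an infinite group, `X = 0`. -/
theorem eq_zero_of_star_mul_uop_mul (hτ : IsFaithfulNormalTrace M τ)
    (ρ : Λ →* unitary M.toStarSubalgebra) {X : M.toStarSubalgebra}
    (h : ∀ g, g ≠ 1 → star X * uop ρ g * X = 0) : X = 0 := by
  have hu : ∀ g, star (uop ρ g) * uop ρ g = 1 := fun g => Unitary.coe_star_mul_self (ρ g)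
  -- These conjugates of `X X*` are orthogonal for `τ`, have equal norms, and all have trace `τ(X
  -- X*)`, so pairing with `1` makes that trace vanish.
  let e : Λ → M.toStarSubalgebra := fun g => uop ρ g * (X * star X) * star (uop ρ g)
  have hstar : ∀ g, star (e g) = e g := fun g => by simp [e, mul_assoc]
  have hmul : ∀ g k, star (e g) * e k
      = uop ρ g * X * (star X * uop ρ (g⁻¹ * k) * X) * star X * star (uop ρ k) := by
    intro g k
    rw [hstar, uop_mul, uop_inv]
    simp only [e]
    noncomm_ring
  have h0 : τ (X * star X) = 0 := by
    refine hτ.eq_zero_of_orthogonal (I := Λ) (x := e) (y := 1) (c := τ (X * star X))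
      (K := (τ (X * star X * (X * star X))).re) ?_ ?_ ?_
    · intro g k hgk
      rw [hmul, h _ (fun h1 => hgk (inv_mul_eq_one.1 h1))]
      simp
    · intro g
      refine le_of_eq ?_
      rw [hmul, inv_mul_cancel, uop_one, hτ.tracial]
      congr 2
      calc star (uop ρ g) * (uop ρ g * X * (star X * 1 * X) * star X)
          = star (uop ρ g) * uop ρ g * (X * star X * (X * star X)) := by noncomm_ring
        _ = _ := by rw [hu, one_mul]
    · intro g
      rw [star_one, one_mul, hτ.tracial, ← mul_assoc, hu, one_mul]
  rw [hτ.tracial] at h0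
  exact hτ.faithful _ h0

end IsFaithfulNormalTrace

end Trace

/-! ### Matrix identities in `SL₂(k)`. -/

section SpecialLinearTwo

variable {k : Type*} [Field k]

/-- The upper unipotent matrix with entry `x`. -/
def upper (x : k) : Matrix.SpecialLinearGroup (Fin 2) k :=
  ⟨!![1, x; 0, 1], by simp [Matrix.det_fin_two_of]⟩

/-- The lower unipotent matrix with entry `x`. -/
def lower (x : k) : Matrix.SpecialLinearGroup (Fin 2) k :=
  ⟨!![1, 0; x, 1], by simp [Matrix.det_fin_two_of]⟩

/-- The diagonal matrix with entries `a` and `a⁻¹`. -/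
def diagTwo (a : kˣ) : Matrix.SpecialLinearGroup (Fin 2) k :=
  ⟨!![(a : k), 0; 0, (a : k)⁻¹], by simp [Matrix.det_fin_two_of]⟩

/-- The antidiagonal matrix with entries `-a⁻¹` and `a`. -/
def weyl (a : kˣ) : Matrix.SpecialLinearGroup (Fin 2) k :=
  ⟨!![0, -(a : k)⁻¹; (a : k), 0], by simp [Matrix.det_fin_two_of]⟩

@[simp]
theorem coe_upper (x : k) : (upper x : Matrix (Fin 2) (Fin 2) k) = !![1, x; 0, 1] := rfl

@[simp]
theorem coe_lower (x : k) : (lower x : Matrix (Fin 2) (Fin 2) k) = !![1, 0; x, 1] := rfl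

@[simp]
theorem coe_diagTwo (a : kˣ) :
    (diagTwo a : Matrix (Fin 2) (Fin 2) k) = !![(a : k), 0; 0, (a : k)⁻¹] := rfl

@[simp]
theorem coe_weyl (a : kˣ) :
    (weyl a : Matrix (Fin 2) (Fin 2) k) = !![0, -(a : k)⁻¹; (a : k), 0] := rfl

theorem upper_mul_upper (x y : k) : upper x * upper y = upper (x + y) := by
  ext i j
  fin_cases i <;> fin_cases j <;> simp [add_comm]

theorem lower_mul_lower (x y : k) : lower x * lower y = lower (x + y) := by
  ext i j
  fin_cases i <;> fin_cases j <;> simp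

theorem upper_zero : upper (0 : k) = 1 := by
  ext i j
  fin_cases i <;> fin_cases j <;> simp

theorem lower_zero : lower (0 : k) = 1 := by
  ext i j
  fin_cases i <;> fin_cases j <;> simp

variable (k) in
/-- The upper unipotent subgroup as a homomorphism. -/
def upperHom : Multiplicative k →* Matrix.SpecialLinearGroup (Fin 2) k where
  toFun x := upper x.toAdd
  map_one' := upper_zero
  map_mul' _ _ := (upper_mul_upper _ _).symm

variable (k) in
/-- The lower unipotent subgroup as a homomorphism. -/
def lowerHom : Multiplicative k →* Matrix.SpecialLinearGroup (Fin 2) k where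
  toFun x := lower x.toAdd
  map_one' := lower_zero
  map_mul' _ _ := (lower_mul_lower _ _).symm

theorem upperHom_ofAdd (x : k) : upperHom k (Multiplicative.ofAdd x) = upper x := rfl

theorem lowerHom_ofAdd (x : k) : lowerHom k (Multiplicative.ofAdd x) = lower x := rfl

variable (k) in
/-- The subgroup of upper triangular matrices. -/
def borel : Subgroup (Matrix.SpecialLinearGroup (Fin 2) k) where
  carrier := {g | g 1 0 = 0}
  mul_mem' {a b} ha hb := by
    simp only [Set.mem_ofPred_eq] at ha hb
    simp [Matrix.mul_apply, ha, hb]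
  one_mem' := by simp
  inv_mem' {a} ha := by
    simp only [Set.mem_ofPred_eq] at ha
    simp [Matrix.adjugate_fin_two, ha]

theorem mem_borel {g : Matrix.SpecialLinearGroup (Fin 2) k} : g ∈ borel k ↔ g 1 0 = 0 := Iff.rfl

theorem upper_mem_borel (x : k) : upper x ∈ borel k := by simp [mem_borel]

theorem diagTwo_mem_borel (a : kˣ) : diagTwo a ∈ borel k := by simp [mem_borel]

theorem diagTwo_mul_upper (a : kˣ) (x : k) :
    diagTwo a * upper x = upper ((a : k) ^ 2 * x) * diagTwo a := by
  have ha := a.ne_zero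
  ext i j
  fin_cases i <;> fin_cases j <;> simp
  field_simp

/-- Up to upper unipotents on both sides, multiplying `lower y` by the torus only rescales `y`. This
makes averages over the lower unipotents insensitive to the torus. -/
theorem lower_mul_diagTwo (a : kˣ) {y : k} (hy : y ≠ 0) :
    ∃ x z, lower y * diagTwo a = upper x * lower (y * a) * upper z := by
  have ha := a.ne_zero
  refine ⟨((a : k) - 1) / (y * a), ((a : k)⁻¹ - 1) / (y * a), ?_⟩
  ext i j
  fin_cases i <;> fin_cases j <;> simp <;> field_simp <;> ring

theorem eq_of_mem_borel {g : Matrix.SpecialLinearGroup (Fin 2) k} (hg : g 1 0 = 0) :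
    ∃ a : kˣ, (a : k) = g 0 0 ∧ ∃ x, g = diagTwo a * upper x := by
  have hdet := g.2
  rw [Matrix.det_fin_two, hg, mul_zero, sub_zero] at hdet
  have h0 : g 0 0 ≠ 0 := left_ne_zero_of_mul_eq_one hdet
  refine ⟨Units.mk0 _ h0, rfl, g 0 1 / g 0 0, ?_⟩
  ext i j
  fin_cases i <;> fin_cases j <;> simp [hg]
  · field_simp
  · exact eq_inv_of_mul_eq_one_right hdet

/-- Bruhat decomposition, with `lower 1` instead of a Weyl element representing the big cell. -/
theorem eq_of_notMem_borel {g : Matrix.SpecialLinearGroup (Fin 2) k} (hg : g 1 0 ≠ 0) :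
    ∃ b ∈ borel k, ∃ b' ∈ borel k, g = b * lower 1 * b' := by
  have hdet := g.2
  rw [Matrix.det_fin_two] at hdet
  refine ⟨upper (g 0 0 / g 1 0 - 1), upper_mem_borel _,
    diagTwo (Units.mk0 _ hg) * upper ((g 1 1 - (g 1 0)⁻¹) / g 1 0),
    mul_mem (diagTwo_mem_borel _) (upper_mem_borel _), ?_⟩
  ext i j
  fin_cases i <;> fin_cases j <;> simp <;> field_simp
  · linear_combination -g 1 0 * hdet
  · ring

theorem lower_eq_upper_mul_weyl (a : kˣ) :
    lower (a : k) = upper (a : k)⁻¹ * weyl a * upper (a : k)⁻¹ := by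
  have ha := a.ne_zero
  ext i j
  fin_cases i <;> fin_cases j <;> simp

theorem upper_mul_weyl (a : kˣ) (x : k) :
    upper x * weyl a = weyl a * lower (-((a : k) ^ 2 * x)) := by
  have ha := a.ne_zero
  ext i j
  fin_cases i <;> fin_cases j <;> simp
  field_simp

theorem exists_conj_apply_zero {g : Matrix.SpecialLinearGroup (Fin 2) k} (hg : g 1 0 ≠ 0) :
    ∃ s : Matrix.SpecialLinearGroup (Fin 2) k, (s * g * s⁻¹) 0 0 = 0 ∧ (s * g * s⁻¹) 1 0 ≠ 0 := by
  refine ⟨upper (-(g 0 0 / g 1 0)), ?_, ?_⟩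
  · simp [Matrix.vecMul, dotProduct, Matrix.mul_apply, Fin.sum_univ_two,
      Matrix.adjugate_fin_two]
    field_simp
    ring
  · simpa [Matrix.vecMul, dotProduct, Matrix.mul_apply, Fin.sum_univ_two,
      Matrix.adjugate_fin_two] using hg

/-- When `g 0 0 = 0`, the quotients of the torus conjugates of `g` are upper triangular, where the
character is computed directly. -/
theorem conj_diagTwo_mul {g : Matrix.SpecialLinearGroup (Fin 2) k} (h0 : g 0 0 = 0) (s r : kˣ) :
    (diagTwo s * g⁻¹ * (diagTwo s)⁻¹ * (diagTwo r * g * (diagTwo r)⁻¹)) 1 0 = 0 ∧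
      (diagTwo s * g⁻¹ * (diagTwo s)⁻¹ * (diagTwo r * g * (diagTwo r)⁻¹)) 0 0
        = (s : k) ^ 2 / (r : k) ^ 2 := by
  have hdet := g.2
  rw [Matrix.det_fin_two, h0] at hdet
  have hs := s.ne_zero
  have hr := r.ne_zero
  constructor
  · simp [Matrix.vecMul, dotProduct, Matrix.mul_apply, Fin.sum_univ_two,
      Matrix.adjugate_fin_two, h0]
  · simp [Matrix.vecMul, dotProduct, Matrix.mul_apply, Fin.sum_univ_two,
      Matrix.adjugate_fin_two, h0]
    field_simp
    linear_combination hdet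

/-- Fourth powers enter because the quotient of two torus conjugates has diagonal entry `s²/r²`, and
`trace_borel_eq` needs the square of that entry to differ from `1`. -/
theorem infinite_range_pow_four [Infinite k] : (Set.range fun s : kˣ => s ^ 4).Infinite := by
  intro hfin
  have hfib : ∀ b : kˣ, ((fun s : kˣ => s ^ 4) ⁻¹' {b}).Finite := by
    intro b
    have h1 : {x : k | (Polynomial.X ^ 4 - Polynomial.C (b : k)).IsRoot x}.Finite :=
      Polynomial.finite_setOfPred_isRoot (Polynomial.X_pow_sub_C_ne_zero (by norm_num) _)
    refine (h1.preimage (f := fun s : kˣ => (s : k)) (Units.val_injective.injOn)).subset ?_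
    intro s hs
    have hs' : s ^ 4 = b := hs
    simp [← hs']
  have h2 : (Set.univ : Set kˣ).Finite := by
    have := hfin.preimage' (f := fun s : kˣ => s ^ 4) fun b _ => hfib b
    rwa [Set.preimage_range] at this
  have : Infinite kˣ := by
    have : Infinite {x : k // x ≠ 0} := (Set.finite_singleton (0 : k)).infinite_compl.to_subtype
    exact Infinite.of_injective (fun x : {x : k // x ≠ 0} => Units.mk0 x.1 x.2)
      (fun x y h => Subtype.ext (by simpa using congrArg Units.val h))
  exact Set.infinite_univ h2

end SpecialLinearTwo

/-! ### Characters of `SL₂(k)` in a finite von Neumann algebra. -/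

section Characters

variable {H : Type*} [NormedAddCommGroup H] [InnerProductSpace ℂ H] [CompleteSpace H]
  {M : VonNeumannAlgebra H} {τ : M.toStarSubalgebra →ₗ[ℂ] ℂ}
  {G Λ Λ' : Type*} [Group G] [Group Λ] [Group Λ']

theorem star_uop_mul_self (φ : G →* unitary M.toStarSubalgebra) (g : G) :
    star (uop φ g) * uop φ g = 1 := Unitary.coe_star_mul_self (φ g)

theorem fixP_comp_mul_uop (φ : G →* unitary M.toStarSubalgebra) {f : Λ →* G} {f' : Λ' →* G} {w : G}
    (h : ∀ g, ∃ g', f g * w = w * f' g') (h' : ∀ g', ∃ g, w * f' g' = f g * w) :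
    fixP (φ.comp f) * uop φ w = uop φ w * fixP (φ.comp f') := by
  refine mul_fixP_eq_fixP_mul (fun g => ?_) (fun g' => ?_)
  · obtain ⟨g', hg'⟩ := h g
    refine ⟨g', ?_⟩
    change uop φ (f g) * uop φ w = uop φ w * uop φ (f' g')
    rw [← uop_mul, hg', uop_mul]
  · obtain ⟨g, hg⟩ := h' g'
    refine ⟨g, ?_⟩
    change uop φ w * uop φ (f' g') = uop φ (f g) * uop φ w
    rw [← uop_mul, hg, uop_mul]

theorem fixP_mul_fixP_comp (φ : G →* unitary M.toStarSubalgebra) (f : Λ →* G) :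
    fixP (φ.comp f) * fixP φ = fixP φ :=
  fixP_mul_eq fun g => uop_mul_fixP φ (f g)

namespace IsFaithfulNormalTrace

theorem uop_conj (hτ : IsFaithfulNormalTrace M τ) (φ : G →* unitary M.toStarSubalgebra) (t g : G) :
    τ (uop φ (t * g * t⁻¹)) = τ (uop φ g) := by
  rw [uop_mul, hτ.tracial, ← uop_mul]
  congr 2
  group

/-- The equality case of Cauchy–Schwarz for `φ(g)Z` and `Z`, which have the same `τ`-norm. -/
theorem uop_mul_eq_self (hτ : IsFaithfulNormalTrace M τ) (φ : G →* unitary M.toStarSubalgebra)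
    {g : G} {Z : M.toStarSubalgebra} (h : τ (star Z * (uop φ g * Z)) = τ (star Z * Z)) :
    uop φ g * Z = Z := by
  have hreal : star (τ (star Z * Z)) = τ (star Z * Z) := by
    rw [← hτ.map_star, star_mul, star_star]
  have h2 : τ (star (uop φ g * Z) * Z) = τ (star Z * Z) := by
    have : star (uop φ g * Z) * Z = star (star Z * (uop φ g * Z)) := by
      rw [star_mul (star Z), star_star]
    rw [this, hτ.map_star, h, hreal]
  have h3 : star (uop φ g * Z) * (uop φ g * Z) = star Z * Z := by
    rw [star_mul, mul_assoc, ← mul_assoc (star (uop φ g)), star_uop_mul_self, one_mul]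
  refine sub_eq_zero.1 (hτ.faithful _ ?_)
  rw [star_sub, sub_mul, mul_sub, mul_sub, h3, map_sub, map_sub, map_sub, h, h2]
  ring

/-- If a group element has infinitely many conjugates whose quotients have trace `τ(R)`, where `R`
is the projection onto the fixed vectors, then it has trace `τ(R)` itself. -/
theorem trace_eq_of_conjugates (hτ : IsFaithfulNormalTrace M τ)
    (φ : G →* unitary M.toStarSubalgebra) {I : Type*} [Infinite I] (g : G) (t : I → G)
    (h : ∀ i j, i ≠ j →
      τ (uop φ (t i * g⁻¹ * (t i)⁻¹ * (t j * g * (t j)⁻¹))) = τ (fixP φ)) :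
    τ (uop φ g) = τ (fixP φ) := by
  rw [← sub_eq_zero]
  have hmul : ∀ i j, star (uop φ (t i * g * (t i)⁻¹) - fixP φ)
      * (uop φ (t j * g * (t j)⁻¹) - fixP φ)
      = uop φ (t i * g⁻¹ * (t i)⁻¹ * (t j * g * (t j)⁻¹)) - fixP φ := by
    intro i j
    rw [star_sub, star_fixP, ← uop_inv, sub_mul, mul_sub, mul_sub, uop_mul_fixP, fixP_mul_uop,
      fixP_mul_self, ← uop_mul, sub_self, sub_zero]
    congr 2
    group
  -- After subtraction of the fixed part, the conjugates of `φ(g)` become orthogonal, while each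
  -- still has trace `τ(φ g) - τ(R)`.
  refine hτ.eq_zero_of_orthogonal (I := I) (x := fun i => uop φ (t i * g * (t i)⁻¹) - fixP φ)
    (y := 1) (K := (τ (1 - fixP φ)).re) ?_ ?_ ?_
  · intro i j hij
    rw [hmul, map_sub, h i j hij, sub_self]
  · intro i
    rw [hmul]
    refine le_of_eq ?_
    rw [show t i * g⁻¹ * (t i)⁻¹ * (t i * g * (t i)⁻¹) = 1 by group, uop_one]
  · intro i
    rw [star_one, one_mul, map_sub, hτ.uop_conj]

end IsFaithfulNormalTrace

section SpecialLinearTwo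

variable {k : Type*} [Field k]

/-- Multiplication by `a` on the additive group of the field, written multiplicatively. -/
def scaleHom (a : k) : Multiplicative k →* Multiplicative k :=
  (AddMonoidHom.mulRight a).toMultiplicative

variable (φ : Matrix.SpecialLinearGroup (Fin 2) k →* unitary M.toStarSubalgebra)

theorem uop_upper_mul_fixP (x : k) :
    uop φ (upper x) * fixP (φ.comp (upperHom k)) = fixP (φ.comp (upperHom k)) :=
  uop_mul_fixP (φ.comp (upperHom k)) (Multiplicative.ofAdd x)

theorem fixP_mul_uop_upper (x : k) :
    fixP (φ.comp (upperHom k)) * uop φ (upper x) = fixP (φ.comp (upperHom k)) :=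
  fixP_mul_uop (φ.comp (upperHom k)) (Multiplicative.ofAdd x)

theorem uop_lower_mul_fixP (x : k) :
    uop φ (lower x) * fixP (φ.comp (lowerHom k)) = fixP (φ.comp (lowerHom k)) :=
  uop_mul_fixP (φ.comp (lowerHom k)) (Multiplicative.ofAdd x)

theorem fixP_mul_uop_lower (x : k) :
    fixP (φ.comp (lowerHom k)) * uop φ (lower x) = fixP (φ.comp (lowerHom k)) :=
  fixP_mul_uop (φ.comp (lowerHom k)) (Multiplicative.ofAdd x)

theorem uop_borel_mul_fixP {b : Matrix.SpecialLinearGroup (Fin 2) k} (hb : b ∈ borel k) :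
    uop φ b * fixP (φ.comp (borel k).subtype) = fixP (φ.comp (borel k).subtype) :=
  uop_mul_fixP (φ.comp (borel k).subtype) ⟨b, hb⟩

theorem fixP_mul_uop_borel {b : Matrix.SpecialLinearGroup (Fin 2) k} (hb : b ∈ borel k) :
    fixP (φ.comp (borel k).subtype) * uop φ b = fixP (φ.comp (borel k).subtype) :=
  fixP_mul_uop (φ.comp (borel k).subtype) ⟨b, hb⟩

theorem fixP_upper_mul_diagTwo (a : kˣ) :
    fixP (φ.comp (upperHom k)) * uop φ (diagTwo a)
      = uop φ (diagTwo a) * fixP (φ.comp (upperHom k)) := by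
  refine fixP_comp_mul_uop φ (fun x => ?_) (fun x => ?_) <;> induction x using Multiplicative.rec
    with | ofAdd x
  · refine ⟨Multiplicative.ofAdd (((a : k) ^ 2)⁻¹ * x), ?_⟩
    rw [upperHom_ofAdd, upperHom_ofAdd, diagTwo_mul_upper,
      mul_inv_cancel_left₀ (pow_ne_zero 2 a.ne_zero)]
  · refine ⟨Multiplicative.ofAdd ((a : k) ^ 2 * x), ?_⟩
    rw [upperHom_ofAdd, upperHom_ofAdd, diagTwo_mul_upper]

theorem fixP_upper_mul_weyl (a : kˣ) :
    fixP (φ.comp (upperHom k)) * uop φ (weyl a)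
      = uop φ (weyl a) * fixP (φ.comp (lowerHom k)) := by
  refine fixP_comp_mul_uop φ (fun x => ?_) (fun x => ?_) <;> induction x using Multiplicative.rec
    with | ofAdd x
  · refine ⟨Multiplicative.ofAdd (-((a : k) ^ 2 * x)), ?_⟩
    rw [upperHom_ofAdd, lowerHom_ofAdd, upper_mul_weyl]
  · refine ⟨Multiplicative.ofAdd (-(((a : k) ^ 2)⁻¹ * x)), ?_⟩
    rw [upperHom_ofAdd, lowerHom_ofAdd, upper_mul_weyl, mul_neg,
      mul_inv_cancel_left₀ (pow_ne_zero 2 a.ne_zero), neg_neg]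

theorem lower_apply_ne {y : k} (hy : y ≠ 0) : lower y 1 0 ≠ 0 := by simpa using hy

variable [Infinite k]

/-- With `Q`, `Q'` the upper and lower projections, `lower_mul_diagTwo` matches the coefficient of
`φ(a)Q` at `y ≠ 0` with that of `Q` at `ya`. Scaling by `a` is an automorphism of `k`, so averaging
gives `τ(Q'φ(a)Q) = τ(Q'Q)`. This is the equality case handled by `uop_mul_eq_self` with `Z = QQ'`.
-/
theorem uop_diagTwo_mul_fixP_mul_fixP (hτ : IsFaithfulNormalTrace M τ) (a : kˣ) :
    uop φ (diagTwo a) * (fixP (φ.comp (upperHom k)) * fixP (φ.comp (lowerHom k)))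
      = fixP (φ.comp (upperHom k)) * fixP (φ.comp (lowerHom k)) := by
  set Q := fixP (φ.comp (upperHom k)) with hQ
  set Q' := fixP (φ.comp (lowerHom k)) with hQ'
  have hscale : fixP ((φ.comp (lowerHom k)).comp (scaleHom (a : k))) = Q' := by
    refine fixP_congr (fun x => ⟨scaleHom (a : k) x, rfl⟩) (fun x => ?_)
    refine ⟨Multiplicative.ofAdd (x.toAdd * (a : k)⁻¹), ?_⟩
    change uop φ (lower x.toAdd) = uop φ (lower (x.toAdd * (a : k)⁻¹ * a))
    rw [inv_mul_cancel_right₀ a.ne_zero]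
  have hmean : τ (Q' * (uop φ (diagTwo a) * Q)) = τ (Q' * Q) := by
    rw [← hscale]
    nth_rw 1 [hscale]
    refine hτ.trace_fixP_eq _ _ fun y hy => ?_
    have hy' : y.toAdd ≠ 0 := hy
    obtain ⟨x, z, hxz⟩ := lower_mul_diagTwo a hy'
    change τ (uop φ (lower y.toAdd) * (uop φ (diagTwo a) * Q)) = τ (uop φ (lower (y.toAdd * a)) * Q)
    rw [← mul_assoc, ← uop_mul, hxz, uop_mul, uop_mul, mul_assoc, uop_upper_mul_fixP, mul_assoc,
      hτ.tracial, mul_assoc, fixP_mul_uop_upper]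
  have hcomm : Q * uop φ (diagTwo a) = uop φ (diagTwo a) * Q := fixP_upper_mul_diagTwo φ a
  have hQQ : Q * Q = Q := fixP_mul_self _
  have hQQ' : Q' * Q' = Q' := fixP_mul_self _
  refine hτ.uop_mul_eq_self φ ?_
  have h1 : star (Q * Q') = Q' * Q := by rw [star_mul, hQ, hQ', star_fixP, star_fixP]
  have h2 : Q' * Q * (uop φ (diagTwo a) * (Q * Q')) = Q' * (uop φ (diagTwo a) * Q) * Q' := by
    calc Q' * Q * (uop φ (diagTwo a) * (Q * Q'))
        = Q' * (Q * uop φ (diagTwo a)) * (Q * Q') := by simp only [mul_assoc]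
      _ = Q' * (uop φ (diagTwo a) * (Q * Q)) * Q' := by rw [hcomm]; simp only [mul_assoc]
      _ = _ := by rw [hQQ]
  have h3 : Q' * Q * (Q * Q') = Q' * Q * Q' := by
    rw [mul_assoc Q', ← mul_assoc Q Q, hQQ, mul_assoc]
  rw [h1, h2, h3, hτ.tracial, ← mul_assoc, hQQ', hmean, hτ.tracial (Q' * Q), ← mul_assoc, hQQ']

/-- By the Bruhat decomposition `S φ(lower y) S` is the same for all `y ≠ 0`, hence equal to its
mean `SQ'S`. So `X = S - Q'S` satisfies `X* φ(lower y) X = 0` for `y ≠ 0`, and finiteness gives `X =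
0`. -/
theorem fixP_lower_mul_fixP_borel (hτ : IsFaithfulNormalTrace M τ) :
    fixP (φ.comp (lowerHom k)) * fixP (φ.comp (borel k).subtype)
      = fixP (φ.comp (borel k).subtype) := by
  set Q' := fixP (φ.comp (lowerHom k)) with hQ'
  set S := fixP (φ.comp (borel k).subtype) with hS
  have hsame : ∀ y : k, y ≠ 0 → S * uop φ (lower y) * S = S * uop φ (lower 1) * S := by
    intro y hy
    obtain ⟨b, hb, b', hb', h⟩ := eq_of_notMem_borel (lower_apply_ne hy)
    rw [h, uop_mul, uop_mul, mul_assoc, mul_assoc, uop_borel_mul_fixP φ hb', ← mul_assoc,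
      ← mul_assoc, fixP_mul_uop_borel φ hb]
  have hcyc : ∀ y x, τ (y * (S * x * S)) = τ (S * y * S * x) := by
    intro y x
    rw [← mul_assoc, hτ.tracial]
    simp only [mul_assoc]
  have hmean : S * Q' * S = S * uop φ (lower 1) * S := by
    refine sub_eq_zero.1 (hτ.eq_zero_of_forall fun x => ?_)
    rw [sub_mul, map_sub, sub_eq_zero, ← hcyc]
    refine hτ.trace_fixP_eq_const _ fun y hy => ?_
    have hy' : y.toAdd ≠ 0 := hy
    change τ (uop φ (lower y.toAdd) * (S * x * S)) = _
    rw [hcyc, hsame _ hy']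
  have hX : S - Q' * S = 0 := by
    refine hτ.eq_zero_of_star_mul_uop_mul (φ.comp (lowerHom k)) fun y hy => ?_
    have hy' : y.toAdd ≠ 0 := hy
    change star (S - Q' * S) * uop φ (lower y.toAdd) * (S - Q' * S) = 0
    have h1 : uop φ (lower y.toAdd) * (S - Q' * S) = uop φ (lower y.toAdd) * S - Q' * S := by
      rw [mul_sub, ← mul_assoc, uop_lower_mul_fixP]
    have h2 : star (S - Q' * S) = S - S * Q' := by
      rw [star_sub, star_mul, hS, hQ', star_fixP, star_fixP]
    rw [mul_assoc, h1, h2, sub_mul, mul_sub, mul_sub, ← mul_assoc, hsame _ hy', ← mul_assoc S Q' S,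
      mul_assoc S Q' (uop φ (lower y.toAdd) * S), ← mul_assoc Q', fixP_mul_uop_lower,
      ← mul_assoc S Q' S, mul_assoc S Q' (Q' * S), ← mul_assoc Q' Q', fixP_mul_self, hmean,
      ← mul_assoc S Q' S, hmean]
    simp
  exact (sub_eq_zero.1 hX).symm

theorem uop_mul_fixP_borel (hτ : IsFaithfulNormalTrace M τ)
    (g : Matrix.SpecialLinearGroup (Fin 2) k) :
    uop φ g * fixP (φ.comp (borel k).subtype) = fixP (φ.comp (borel k).subtype) := by
  by_cases hg : g 1 0 = 0
  · exact uop_borel_mul_fixP φ hg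
  · obtain ⟨b, hb, b', hb', h⟩ := eq_of_notMem_borel hg
    have h1 : uop φ (lower 1) * fixP (φ.comp (borel k).subtype)
        = fixP (φ.comp (borel k).subtype) := by
      rw [← fixP_lower_mul_fixP_borel φ hτ, ← mul_assoc, uop_lower_mul_fixP]
    rw [h, uop_mul, uop_mul, mul_assoc, mul_assoc, uop_borel_mul_fixP φ hb', h1,
      uop_borel_mul_fixP φ hb]

theorem fixP_borel_eq (hτ : IsFaithfulNormalTrace M τ) :
    fixP (φ.comp (borel k).subtype) = fixP φ := by
  have h1 : fixP φ * fixP (φ.comp (borel k).subtype) = fixP (φ.comp (borel k).subtype) :=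
    fixP_mul_eq (uop_mul_fixP_borel φ hτ)
  have h2 := congrArg star (fixP_mul_fixP_comp φ (borel k).subtype)
  rw [star_mul, star_fixP, star_fixP] at h2
  rw [← h1, h2]

/-- The range of `QQ'` is fixed by the upper unipotents and by the torus, hence by the Borel
subgroup, hence by everything. -/
theorem fixP_upper_mul_fixP_lower (hτ : IsFaithfulNormalTrace M τ) :
    fixP (φ.comp (upperHom k)) * fixP (φ.comp (lowerHom k)) = fixP φ := by
  set Q := fixP (φ.comp (upperHom k)) with hQ
  set Q' := fixP (φ.comp (lowerHom k)) with hQ'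
  have h1 : fixP (φ.comp (borel k).subtype) * (Q * Q') = Q * Q' := by
    refine fixP_mul_eq fun b => ?_
    obtain ⟨a, -, x, hb⟩ := eq_of_mem_borel b.2
    change uop φ b * (Q * Q') = Q * Q'
    rw [hb, uop_mul, mul_assoc, ← mul_assoc (uop φ (upper x)), uop_upper_mul_fixP,
      uop_diagTwo_mul_fixP_mul_fixP φ hτ]
  have h2 := congrArg star (fixP_mul_fixP_comp φ (upperHom k))
  have h3 := congrArg star (fixP_mul_fixP_comp φ (lowerHom k))
  rw [star_mul, star_fixP, star_fixP] at h2 h3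
  rw [← h1, fixP_borel_eq φ hτ, ← mul_assoc, h2, h3]

/-- For a unitary representation of `SL₂(k)` in a finite von Neumann algebra, vectors fixed by the
upper unipotent matrices are fixed by the whole group. -/
theorem fixP_upper_eq (hτ : IsFaithfulNormalTrace M τ) :
    fixP (φ.comp (upperHom k)) = fixP φ := by
  set Q := fixP (φ.comp (upperHom k)) with hQ
  have hQR : Q * fixP φ = fixP φ := fixP_mul_fixP_comp φ _
  have hRQ : fixP φ * Q = fixP φ := by
    have := congrArg star hQR
    rwa [star_mul, hQ, star_fixP, star_fixP] at this
  refine sub_eq_zero.1 (hτ.eq_zero_of_star_mul_uop_mul (φ.comp (lowerHom k)) fun y hy => ?_)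
  have hy' : y.toAdd ≠ 0 := hy
  change star (Q - fixP φ) * uop φ (lower y.toAdd) * (Q - fixP φ) = 0
  -- Since `lower y = upper y⁻¹ · w · upper y⁻¹`, the compression is `QwQ = wQ'Q = wR = R`. Thus `Q
  -- - R` meets the finiteness criterion for the lower unipotents.
  have h1 : Q * (uop φ (lower y.toAdd) * Q) = fixP φ := by
    have e : lower y.toAdd = upper (y.toAdd)⁻¹ * weyl (Units.mk0 _ hy') * upper (y.toAdd)⁻¹ :=
      lower_eq_upper_mul_weyl (Units.mk0 _ hy')
    have h2 := congrArg star (fixP_upper_mul_fixP_lower φ hτ)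
    rw [star_mul, star_fixP, star_fixP, star_fixP] at h2
    rw [e, uop_mul, uop_mul, mul_assoc, uop_upper_mul_fixP, mul_assoc, ← mul_assoc,
      fixP_mul_uop_upper, ← mul_assoc, fixP_upper_mul_weyl, mul_assoc, h2, uop_mul_fixP]
  rw [star_sub, hQ, star_fixP, star_fixP, ← hQ, mul_assoc, mul_sub, uop_mul_fixP, sub_mul, mul_sub,
    mul_sub, h1, hQR, ← mul_assoc, fixP_mul_uop, hRQ, fixP_mul_self]
  simp

theorem fixP_lower_eq (hτ : IsFaithfulNormalTrace M τ) :
    fixP (φ.comp (lowerHom k)) = fixP φ := by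
  have h := fixP_upper_mul_weyl φ (1 : kˣ)
  rw [fixP_upper_eq φ hτ, fixP_mul_uop] at h
  have h2 := congrArg (fun x => star (uop φ (weyl (1 : kˣ))) * x) h
  simp only [← mul_assoc, star_uop_mul_self, one_mul] at h2
  rw [← uop_inv, uop_mul_fixP] at h2
  exact h2.symm

/-- If `a² ≠ 1`, every `upper y * diagTwo a` is conjugate to `diagTwo a`. The character is therefore
constant along this coset and equals its mean, computed by the upper projection, which is `R`. -/
theorem trace_borel_eq (hτ : IsFaithfulNormalTrace M τ) {g : Matrix.SpecialLinearGroup (Fin 2) k}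
    (hg : g 1 0 = 0) (hg2 : g 0 0 ^ 2 ≠ 1) : τ (uop φ g) = τ (fixP φ) := by
  obtain ⟨a, ha, x, rfl⟩ := eq_of_mem_borel hg
  rw [← ha] at hg2
  have hne : 1 - (a : k) ^ 2 ≠ 0 := sub_ne_zero.2 (Ne.symm hg2)
  have hconj : ∀ y, τ (uop φ (upper y * diagTwo a)) = τ (uop φ (diagTwo a)) := by
    intro y
    have e : upper y * diagTwo a
        = upper (y / (1 - (a : k) ^ 2)) * diagTwo a * (upper (y / (1 - (a : k) ^ 2)))⁻¹ := by
      rw [eq_mul_inv_iff_mul_eq, mul_assoc, diagTwo_mul_upper, ← mul_assoc, upper_mul_upper]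
      congr 2
      field_simp
      ring
    rw [e, hτ.uop_conj]
  have hmean : τ (fixP φ * uop φ (diagTwo a)) = τ (uop φ (diagTwo a)) := by
    rw [← fixP_upper_eq φ hτ]
    refine hτ.trace_fixP_eq_const _ fun y _ => ?_
    change τ (uop φ (upper y.toAdd) * uop φ (diagTwo a)) = _
    rw [← uop_mul, hconj]
  rw [fixP_mul_uop] at hmean
  rw [diagTwo_mul_upper, hconj, hmean]

/-- The character of a representation of `SL₂(k)` is constant off the upper triangular matrices. -/
theorem trace_eq_of_apply_ne_zero (hτ : IsFaithfulNormalTrace M τ)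
    {g : Matrix.SpecialLinearGroup (Fin 2) k} (hg : g 1 0 ≠ 0) : τ (uop φ g) = τ (fixP φ) := by
  obtain ⟨s, hs, -⟩ := exists_conj_apply_zero hg
  rw [← hτ.uop_conj φ s]
  have := (infinite_range_pow_four (k := k)).to_subtype
  refine hτ.trace_eq_of_conjugates φ (I := Set.range fun s : kˣ => s ^ 4) _
    (fun i => diagTwo i.2.choose) fun i j hij => ?_
  obtain ⟨h1, h2⟩ := conj_diagTwo_mul hs i.2.choose j.2.choose
  refine trace_borel_eq φ hτ h1 ?_
  rw [h2]
  intro h3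
  apply hij
  have hi : i.2.choose ^ 4 = (i : kˣ) := i.2.choose_spec
  have hj : j.2.choose ^ 4 = (j : kˣ) := j.2.choose_spec
  have hjne : ((j.2.choose : kˣ) : k) ≠ 0 := Units.ne_zero _
  rw [← Subtype.coe_inj, ← hi, ← hj, ← Units.val_inj]
  push_cast
  rw [div_pow, div_eq_one_iff_eq (by positivity), ← pow_mul, ← pow_mul] at h3
  exact h3

end SpecialLinearTwo

end Characters

/-! ### Transvection groups and the copies of `SL₂(k)` they generate. -/

section TransvectionGroups

variable {n k : Type*} [Fintype n] [DecidableEq n] [Field k]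

theorem det_one_add_smul_vecMulVec {ξ f : n → k} (h : f ⬝ᵥ ξ = 0) (x : k) :
    (1 + x • Matrix.vecMulVec ξ f).det = 1 := by
  rw [← Matrix.smul_vecMulVec, Matrix.vecMulVec_eq Unit,
    Matrix.det_one_add_replicateCol_mul_replicateRow, dotProduct_smul, h, smul_zero, add_zero]

/-- The group of transvections `1 + x ξ ⊗ f`, for a vector `ξ` in the kernel of `f`. -/
def transvecHom (ξ f : n → k) (h : f ⬝ᵥ ξ = 0) :
    Multiplicative k →* Matrix.SpecialLinearGroup n k where
  toFun x := ⟨1 + x.toAdd • Matrix.vecMulVec ξ f, det_one_add_smul_vecMulVec h _⟩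
  map_one' := by
    refine Subtype.ext ?_
    simp
  map_mul' x y := by
    refine Subtype.ext ?_
    have h0 : Matrix.vecMulVec ξ f * Matrix.vecMulVec ξ f = 0 := by
      rw [Matrix.vecMulVec_mul_vecMulVec, h, zero_smul, Matrix.vecMulVec_zero]
    change 1 + (x.toAdd + y.toAdd) • Matrix.vecMulVec ξ f
      = (1 + x.toAdd • Matrix.vecMulVec ξ f) * (1 + y.toAdd • Matrix.vecMulVec ξ f)
    rw [mul_add, mul_one, add_mul, one_mul, smul_mul_assoc, mul_smul_comm, h0, smul_zero,
      smul_zero, add_zero, add_smul, add_assoc]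

theorem coe_transvecHom (ξ f : n → k) (h : f ⬝ᵥ ξ = 0) (x : Multiplicative k) :
    (transvecHom ξ f h x : Matrix n n k) = 1 + x.toAdd • Matrix.vecMulVec ξ f := rfl

/-- The middle factor `BA` cancels in the product of `A(x-1)B` and `A(y-1)B`. -/
theorem one_add_mul_sub_one_mul {A : Matrix n (Fin 2) k} {B : Matrix (Fin 2) n k} (h : B * A = 1)
    (x y : Matrix (Fin 2) (Fin 2) k) :
    1 + A * (x * y - 1) * B = (1 + A * (x - 1) * B) * (1 + A * (y - 1) * B) := by
  have e : A * (x - 1) * B * (A * (y - 1) * B) = A * ((x - 1) * (y - 1)) * B := by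
    calc A * (x - 1) * B * (A * (y - 1) * B)
        = A * (x - 1) * (B * A) * (y - 1) * B := by simp only [Matrix.mul_assoc]
      _ = _ := by rw [h, Matrix.mul_one]; simp only [Matrix.mul_assoc]
  have e2 : x * y - 1 = (x - 1) + (y - 1) + (x - 1) * (y - 1) := by noncomm_ring
  rw [add_mul, mul_add, mul_add, e, e2, Matrix.mul_add, Matrix.mul_add, Matrix.add_mul,
    Matrix.add_mul, one_mul, one_mul, mul_one]
  abel

/-- The embedding `g ↦ 1 + A (g - 1) B` of `SL₂` given by a pair of matrices with `B A = 1`. -/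
def embTwo (A : Matrix n (Fin 2) k) (B : Matrix (Fin 2) n k) (h : B * A = 1) :
    Matrix.SpecialLinearGroup (Fin 2) k →* Matrix.SpecialLinearGroup n k where
  toFun g := ⟨1 + A * ((g : Matrix (Fin 2) (Fin 2) k) - 1) * B, by
    rw [Matrix.mul_assoc, Matrix.det_one_add_mul_comm, Matrix.mul_assoc, h, Matrix.mul_one,
      add_sub_cancel]
    exact g.2⟩
  map_one' := by
    refine Subtype.ext ?_
    simp
  map_mul' x y := Subtype.ext (one_add_mul_sub_one_mul h x y)

theorem coe_embTwo (A : Matrix n (Fin 2) k) (B : Matrix (Fin 2) n k) (h : B * A = 1)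
    (g : Matrix.SpecialLinearGroup (Fin 2) k) :
    (embTwo A B h g : Matrix n n k) = 1 + A * ((g : Matrix (Fin 2) (Fin 2) k) - 1) * B := rfl

/-- Two opposite transvection groups generate a copy of `SL₂`. -/
theorem exists_embTwo {ξ f ξ' f' : n → k} (h : f ⬝ᵥ ξ = 0) (h' : f' ⬝ᵥ ξ' = 0)
    (hα : f ⬝ᵥ ξ' ≠ 0) (hβ : f' ⬝ᵥ ξ ≠ 0) :
    ∃ j : Matrix.SpecialLinearGroup (Fin 2) k →* Matrix.SpecialLinearGroup n k,
      (∀ x : k, j (upper (f ⬝ᵥ ξ' * x)) = transvecHom ξ f h (Multiplicative.ofAdd x)) ∧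
      (∀ x : k, j (lower (f' ⬝ᵥ ξ * x)) = transvecHom ξ' f' h' (Multiplicative.ofAdd x)) ∧
      (∀ a : kˣ, (j (diagTwo a) : Matrix n n k) = 1
        + (((a : k) - 1) * (f' ⬝ᵥ ξ)⁻¹) • Matrix.vecMulVec ξ f'
        + (((a : k)⁻¹ - 1) * (f ⬝ᵥ ξ')⁻¹) • Matrix.vecMulVec ξ' f) := by
  have hBA : Matrix.of ![(f' ⬝ᵥ ξ)⁻¹ • f', (f ⬝ᵥ ξ')⁻¹ • f] *
      (Matrix.of ![ξ, ξ']).transpose = 1 := by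
    ext i j
    rw [Matrix.mul_apply']
    fin_cases i <;> fin_cases j
    · change ((f' ⬝ᵥ ξ)⁻¹ • f') ⬝ᵥ ξ = 1
      rw [smul_dotProduct, smul_eq_mul, inv_mul_cancel₀ hβ]
    · change ((f' ⬝ᵥ ξ)⁻¹ • f') ⬝ᵥ ξ' = 0
      rw [smul_dotProduct, h', smul_zero]
    · change ((f ⬝ᵥ ξ')⁻¹ • f) ⬝ᵥ ξ = 0
      rw [smul_dotProduct, h, smul_zero]
    · change ((f ⬝ᵥ ξ')⁻¹ • f) ⬝ᵥ ξ' = 1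
      rw [smul_dotProduct, smul_eq_mul, inv_mul_cancel₀ hα]
  have hentry : ∀ (g : Matrix (Fin 2) (Fin 2) k),
      (Matrix.of ![ξ, ξ']).transpose * g * Matrix.of ![(f' ⬝ᵥ ξ)⁻¹ • f', (f ⬝ᵥ ξ')⁻¹ • f]
      = (g 0 0 * (f' ⬝ᵥ ξ)⁻¹) • Matrix.vecMulVec ξ f' + (g 0 1 * (f ⬝ᵥ ξ')⁻¹) • Matrix.vecMulVec ξ f
      + (g 1 0 * (f' ⬝ᵥ ξ)⁻¹) • Matrix.vecMulVec ξ' f'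
      + (g 1 1 * (f ⬝ᵥ ξ')⁻¹) • Matrix.vecMulVec ξ' f := by
    intro g
    ext i j
    simp [Matrix.mul_apply, Fin.sum_univ_two, Matrix.vecMulVec_apply]
    ring
  refine ⟨embTwo _ _ hBA, fun x => ?_, fun x => ?_, fun a => ?_⟩
  · refine Subtype.ext ?_
    rw [coe_embTwo, hentry, coe_transvecHom]
    simp [hα, mul_comm]
  · refine Subtype.ext ?_
    rw [coe_embTwo, hentry, coe_transvecHom]
    simp [hβ, mul_comm]
  · rw [coe_embTwo, hentry]
    simp [add_assoc]

/-- Functionals detecting `a` and `b` exist separately; if neither detects both vectors, their sum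
does. -/
theorem exists_dotProduct_ne_zero {a b c : n → k} (ha : a ∉ Submodule.span k {c})
    (hb : b ∉ Submodule.span k {c}) : ∃ f : n → k, f ⬝ᵥ c = 0 ∧ f ⬝ᵥ a ≠ 0 ∧ f ⬝ᵥ b ≠ 0 := by
  have key : ∀ v, v ∉ Submodule.span k {c} → ∃ f : n → k, f ⬝ᵥ c = 0 ∧ f ⬝ᵥ v ≠ 0 := by
    intro v hv
    obtain ⟨F, hF, hker⟩ := Submodule.exists_le_ker_of_notMem hv
    have hdot : ∀ w, (dotProductEquiv k n).symm F ⬝ᵥ w = F w := fun w => by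
      exact congrArg (fun G : Module.Dual k (n → k) => G w)
        ((dotProductEquiv k n).apply_symm_apply F)
    refine ⟨(dotProductEquiv k n).symm F, ?_, ?_⟩
    · rw [hdot]
      exact hker (Submodule.mem_span_singleton_self c)
    · rwa [hdot]
  obtain ⟨f₁, h₁c, h₁a⟩ := key a ha
  obtain ⟨f₂, h₂c, h₂b⟩ := key b hb
  by_cases h₁b : f₁ ⬝ᵥ b = 0
  · by_cases h₂a : f₂ ⬝ᵥ a = 0
    · refine ⟨f₁ + f₂, ?_, ?_, ?_⟩
      · rw [add_dotProduct, h₁c, h₂c, add_zero]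
      · rwa [add_dotProduct, h₂a, add_zero]
      · rwa [add_dotProduct, h₁b, zero_add]
    · exact ⟨f₂, h₂c, h₂a, h₂b⟩
  · exact ⟨f₁, h₁c, h₁a, h₁b⟩

/-- Any two transvection groups have a common opposite. -/
theorem exists_common_opposite {ξ f ξ' f' : n → k} (h : f ⬝ᵥ ξ = 0) (h' : f' ⬝ᵥ ξ' = 0)
    (hξ : ξ ≠ 0) (hf : f ≠ 0) (hξ' : ξ' ≠ 0) (hf' : f' ≠ 0) :
    ∃ ξ'' f'' : n → k, f'' ⬝ᵥ ξ'' = 0 ∧ f ⬝ᵥ ξ'' ≠ 0 ∧ f'' ⬝ᵥ ξ ≠ 0 ∧ f' ⬝ᵥ ξ'' ≠ 0 ∧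
      f'' ⬝ᵥ ξ' ≠ 0 := by
  obtain ⟨ξ'', -, h₁, h₂⟩ := exists_dotProduct_ne_zero (a := f) (b := f') (c := 0)
    (by simpa using hf) (by simpa using hf')
  rw [dotProduct_comm] at h₁ h₂
  -- A nonzero vector killed by `e` is not a multiple of one that `e` does not kill.
  have hnot : ∀ ζ e : n → k, e ⬝ᵥ ζ = 0 → ζ ≠ 0 → e ⬝ᵥ ξ'' ≠ 0 → ζ ∉ Submodule.span k {ξ''} := by
    intro ζ e he hζ hne hmem
    obtain ⟨c, rfl⟩ := Submodule.mem_span_singleton.1 hmem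
    rw [dotProduct_smul, smul_eq_mul, mul_eq_zero] at he
    rcases he with rfl | he
    · exact hζ (zero_smul _ _)
    · exact hne he
  obtain ⟨f'', h0, h₃, h₄⟩ := exists_dotProduct_ne_zero (hnot ξ f h hξ h₁) (hnot ξ' f' h' hξ' h₂)
  exact ⟨ξ'', f'', h0, h₁, h₃, h₂, h₄⟩

/-- A matrix for which every nonzero vector is an eigenvector is scalar, hence central. -/
theorem exists_mulVec_notMem_span {g : Matrix.SpecialLinearGroup n k}
    (hg : g ∉ Subgroup.center (Matrix.SpecialLinearGroup n k)) :
    ∃ ξ : n → k, ξ ≠ 0 ∧ (g : Matrix n n k).mulVec ξ ∉ Submodule.span k {ξ} := by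
  by_contra! hcon
  apply hg
  obtain ⟨a, ha⟩ := LinearMap.exists_eq_smul_id_of_forall_notLinearIndependent
    (f := Matrix.mulVecLin (g : Matrix n n k)) (fun v hv => by
      have hv0 : v ≠ 0 := by simpa using hv.ne_zero 0
      obtain ⟨c, hc⟩ := Submodule.mem_span_singleton.1 (hcon v hv0)
      exact (LinearIndependent.pair_iff' hv0).1 hv c hc)
  have hscalar : Matrix.scalar n a = (g : Matrix n n k) := by
    refine Matrix.ext_of_mulVec_single fun i => ?_
    have := congrArg (fun T : (n → k) →ₗ[k] (n → k) => T (Pi.single i 1)) ha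
    simpa [Matrix.scalar_apply, Matrix.diagonal_mulVec_single, ← Pi.single_smul] using this.symm
  rw [Matrix.SpecialLinearGroup.mem_center_iff]
  refine ⟨a, ?_, hscalar⟩
  have := g.2
  rw [← hscalar] at this
  simpa using this

theorem dotProduct_single_single {i j : n} (hij : i ≠ j) :
    (Pi.single j (1 : k) : n → k) ⬝ᵥ Pi.single i 1 = 0 := by
  simp [hij]

theorem inv_mul_transvecHom_mul (g : Matrix.SpecialLinearGroup n k) {ξ f : n → k}
    (h : f ⬝ᵥ ξ = 0)
    (h' : Matrix.vecMul f (g : Matrix n n k) ⬝ᵥ (↑g⁻¹ : Matrix n n k).mulVec ξ = 0)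
    (x : Multiplicative k) :
    g⁻¹ * transvecHom ξ f h x * g
      = transvecHom ((↑g⁻¹ : Matrix n n k).mulVec ξ) (Matrix.vecMul f (g : Matrix n n k)) h' x := by
  refine Subtype.ext ?_
  change (↑g⁻¹ : Matrix n n k) * (1 + x.toAdd • Matrix.vecMulVec ξ f) * (g : Matrix n n k)
    = 1 + x.toAdd • Matrix.vecMulVec ((↑g⁻¹ : Matrix n n k).mulVec ξ)
      (Matrix.vecMul f (g : Matrix n n k))
  have hinv : (↑g⁻¹ : Matrix n n k) * (g : Matrix n n k) = 1 :=
    congrArg Subtype.val (inv_mul_cancel g)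
  rw [mul_add, add_mul, mul_one, hinv, Matrix.mul_smul, Matrix.smul_mul, Matrix.mul_vecMulVec,
    Matrix.vecMulVec_mul]

end TransvectionGroups

/-! ### Character rigidity for `SLₙ(k)`. -/

section Rigidity

variable {H : Type*} [NormedAddCommGroup H] [InnerProductSpace ℂ H] [CompleteSpace H]
  {M : VonNeumannAlgebra H} {τ : M.toStarSubalgebra →ₗ[ℂ] ℂ}
  {n k : Type*} [Fintype n] [DecidableEq n] [Field k] [Infinite k]
  (φ : Matrix.SpecialLinearGroup n k →* unitary M.toStarSubalgebra)

/-- The transvection group is, up to rescaling its parameter, a unipotent subgroup of the copy of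
`SL₂`, so `fixP_upper_eq` or `fixP_lower_eq` applies to `φ ∘ j`. -/
theorem fixP_transvecHom_eq_embTwo (hτ : IsFaithfulNormalTrace M τ) {ξ f : n → k} (h : f ⬝ᵥ ξ = 0)
    {α : k} (hα : α ≠ 0) {j : Matrix.SpecialLinearGroup (Fin 2) k →* Matrix.SpecialLinearGroup n k}
    (hj : (∀ x : k, j (upper (α * x)) = transvecHom ξ f h (Multiplicative.ofAdd x)) ∨
      (∀ x : k, j (lower (α * x)) = transvecHom ξ f h (Multiplicative.ofAdd x))) :
    fixP (φ.comp (transvecHom ξ f h)) = fixP (φ.comp j) := by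
  rcases hj with hj | hj
  · rw [← fixP_upper_eq (φ.comp j) hτ]
    refine fixP_congr (fun x => ⟨Multiplicative.ofAdd (α * x.toAdd), ?_⟩)
      (fun x => ⟨Multiplicative.ofAdd (α⁻¹ * x.toAdd), ?_⟩)
    · exact congrArg (uop φ) (hj x.toAdd).symm
    · refine congrArg (uop φ) (Eq.trans ?_ (hj (α⁻¹ * x.toAdd)))
      rw [mul_inv_cancel_left₀ hα]
      rfl
  · rw [← fixP_lower_eq (φ.comp j) hτ]
    refine fixP_congr (fun x => ⟨Multiplicative.ofAdd (α * x.toAdd), ?_⟩)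
      (fun x => ⟨Multiplicative.ofAdd (α⁻¹ * x.toAdd), ?_⟩)
    · exact congrArg (uop φ) (hj x.toAdd).symm
    · refine congrArg (uop φ) (Eq.trans ?_ (hj (α⁻¹ * x.toAdd)))
      rw [mul_inv_cancel_left₀ hα]
      rfl

theorem fixP_transvecHom_eq_of_opposite (hτ : IsFaithfulNormalTrace M τ) {ξ f ξ' f' : n → k}
    (h : f ⬝ᵥ ξ = 0) (h' : f' ⬝ᵥ ξ' = 0) (hα : f ⬝ᵥ ξ' ≠ 0) (hβ : f' ⬝ᵥ ξ ≠ 0) :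
    fixP (φ.comp (transvecHom ξ f h)) = fixP (φ.comp (transvecHom ξ' f' h')) := by
  obtain ⟨j, hu, hl, -⟩ := exists_embTwo h h' hα hβ
  rw [fixP_transvecHom_eq_embTwo φ hτ h hα (Or.inl hu),
    fixP_transvecHom_eq_embTwo φ hτ h' hβ (Or.inr hl)]

theorem fixP_transvecHom_eq (hτ : IsFaithfulNormalTrace M τ) {ξ f ξ' f' : n → k}
    (h : f ⬝ᵥ ξ = 0) (h' : f' ⬝ᵥ ξ' = 0) (hξ : ξ ≠ 0) (hf : f ≠ 0) (hξ' : ξ' ≠ 0) (hf' : f' ≠ 0) :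
    fixP (φ.comp (transvecHom ξ f h)) = fixP (φ.comp (transvecHom ξ' f' h')) := by
  obtain ⟨ξ'', f'', h'', h₁, h₂, h₃, h₄⟩ := exists_common_opposite h h' hξ hf hξ' hf'
  rw [fixP_transvecHom_eq_of_opposite φ hτ h h'' h₁ h₂,
    fixP_transvecHom_eq_of_opposite φ hτ h' h'' h₃ h₄]

/-- Vectors fixed by one transvection group are fixed by all of `SLₙ(k)`. -/
theorem fixP_transvecHom_eq_fixP [Nontrivial n] (hτ : IsFaithfulNormalTrace M τ) {ξ f : n → k}
    (h : f ⬝ᵥ ξ = 0) (hξ : ξ ≠ 0) (hf : f ≠ 0) :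
    fixP (φ.comp (transvecHom ξ f h)) = fixP φ := by
  set E := fixP (φ.comp (transvecHom ξ f h)) with hE
  have hsingle : ∀ i : n, (Pi.single i (1 : k) : n → k) ≠ 0 := fun i => by simp
  have hEij : ∀ (i j : n) (hij : i ≠ j),
      fixP (φ.comp (transvecHom (Pi.single i 1) (Pi.single j 1) (dotProduct_single_single hij)))
        = E := fun i j hij =>
    fixP_transvecHom_eq φ hτ _ h (hsingle i) (hsingle j) hξ hf
  have hall : ∀ g, uop φ g * E = E := by
    intro g
    refine Matrix.SpecialLinearGroup.diagonal_transvection_induction'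
      (fun g => uop φ g * E = E) g ?_ ?_ ?_
    -- The diagonal generator is the image of `diagTwo` in the copy of `SL₂` spanned by two opposite
    -- elementary transvection groups, whose fixed-point projection is `E`.
    · intro i j hij c hc
      obtain ⟨J, hu, -, hd⟩ := exists_embTwo (k := k) (dotProduct_single_single hij)
        (dotProduct_single_single hij.symm) (by simp) (by simp)
      have h1 := fixP_transvecHom_eq_embTwo φ hτ _ (by simp) (Or.inl hu)
      have h2 : J (diagTwo (Units.mk0 c hc)) = Matrix.SpecialLinearGroup.diag2n hij c hc := by
        refine Subtype.ext ((hd _).trans ?_)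
        rw [Matrix.SpecialLinearGroup.diag2n_coe]
        ext a b
        by_cases hab : a = b
        · subst hab
          by_cases hai : a = i
          · subst hai
            simp [Matrix.vecMulVec_apply, hij]
          · by_cases haj : a = j
            · subst haj
              simp [Matrix.vecMulVec_apply, hai]
            · simp [Matrix.vecMulVec_apply, hai, haj]
        · simp [Matrix.vecMulVec_apply, hab, Pi.single_apply]
          grind
      have h3 := uop_mul_fixP (φ.comp J) (diagTwo (Units.mk0 c hc))
      rw [← h1, hEij i j hij] at h3
      rw [← h2]
      exact h3
    · intro i j hij a
      have h1 := uop_mul_fixP (φ.comp (transvecHom (Pi.single i 1) (Pi.single j 1)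
        (dotProduct_single_single hij))) (Multiplicative.ofAdd a)
      rw [hEij i j hij] at h1
      have h2 : transvecHom (Pi.single i 1) (Pi.single j 1) (dotProduct_single_single hij)
          (Multiplicative.ofAdd a) = Matrix.SpecialLinearGroup.transvection hij a := by
        refine Subtype.ext ?_
        rw [coe_transvecHom, Matrix.SpecialLinearGroup.transvection_coe,
          ← Matrix.single_eq_single_vecMulVec_single]
        simp
      rw [← h2]
      exact h1
    · intro A B hA hB
      rw [uop_mul, mul_assoc, hB, hA]
  have h1 : fixP φ * E = E := fixP_mul_eq hall
  have h2 := congrArg star (fixP_mul_fixP_comp φ (transvecHom ξ f h))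
  rw [star_mul, star_fixP, star_fixP] at h2
  rw [← h1, h2]

/-- Character rigidity: the character of a representation of `SLₙ(k)` in a finite von Neumann
algebra is constant on the noncentral elements. -/
theorem trace_eq_of_notMem_center [Nontrivial n] (hτ : IsFaithfulNormalTrace M τ)
    {g : Matrix.SpecialLinearGroup n k}
    (hg : g ∉ Subgroup.center (Matrix.SpecialLinearGroup n k)) :
    τ (uop φ g) = τ (fixP φ) := by
  obtain ⟨ξ, hξ, hgξ⟩ := exists_mulVec_notMem_span hg
  have hinv : (↑g⁻¹ : Matrix n n k) * (g : Matrix n n k) = 1 :=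
    congrArg Subtype.val (inv_mul_cancel g)
  have hinv' : (g : Matrix n n k) * (↑g⁻¹ : Matrix n n k) = 1 :=
    congrArg Subtype.val (mul_inv_cancel g)
  have hgξ' : (↑g⁻¹ : Matrix n n k).mulVec ξ ∉ Submodule.span k {ξ} := by
    intro hmem
    obtain ⟨c, hc⟩ := Submodule.mem_span_singleton.1 hmem
    have h1 : c • (g : Matrix n n k).mulVec ξ = ξ := by
      rw [← Matrix.mulVec_smul, hc, Matrix.mulVec_mulVec, hinv', Matrix.one_mulVec]
    have hc0 : c ≠ 0 := by
      rintro rfl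
      exact hξ (by simpa using h1.symm)
    apply hgξ
    rw [Submodule.mem_span_singleton]
    exact ⟨c⁻¹, by rw [inv_smul_eq_iff₀ hc0, h1]⟩
  -- The two nonvanishing conditions say exactly that the transvection group of `ξ`, `f` and its
  -- conjugate by `g⁻¹` are opposite.
  obtain ⟨f, hfξ, hβ, hα⟩ := exists_dotProduct_ne_zero hgξ hgξ'
  have hf0 : f ≠ 0 := by
    rintro rfl
    exact hβ (zero_dotProduct _)
  have h' : Matrix.vecMul f (g : Matrix n n k) ⬝ᵥ (↑g⁻¹ : Matrix n n k).mulVec ξ = 0 := by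
    rw [← Matrix.dotProduct_mulVec, Matrix.mulVec_mulVec, hinv', Matrix.one_mulVec, hfξ]
  have hβ' : Matrix.vecMul f (g : Matrix n n k) ⬝ᵥ ξ ≠ 0 := by rwa [← Matrix.dotProduct_mulVec]
  obtain ⟨j, hu, hl, -⟩ := exists_embTwo hfξ h' hα hβ'
  have hfix : fixP (φ.comp j) = fixP φ := by
    rw [← fixP_transvecHom_eq_embTwo φ hτ hfξ hα (Or.inl hu),
      fixP_transvecHom_eq_fixP φ hτ hfξ hξ hf0]
  refine hτ.trace_eq_of_conjugates φ (I := Multiplicative k) g (transvecHom ξ f hfξ)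
    fun a b hab => ?_
  have hc : a⁻¹ * b ≠ 1 := fun h => hab (inv_mul_eq_one.1 h)
  have hc' : (a⁻¹ * b).toAdd ≠ 0 := hc
  -- The quotient of two conjugates is conjugate to `(g⁻¹ t g) t⁻¹` with `t` a nontrivial
  -- transvection. It is a lower times an upper unipotent of the copy `j` of `SL₂`, with nonzero
  -- lower left entry.
  have e : transvecHom ξ f hfξ a * g⁻¹ * (transvecHom ξ f hfξ a)⁻¹ *
      (transvecHom ξ f hfξ b * g * (transvecHom ξ f hfξ b)⁻¹)
      = transvecHom ξ f hfξ a * (g⁻¹ * transvecHom ξ f hfξ (a⁻¹ * b) * g *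
        transvecHom ξ f hfξ (a⁻¹ * b)⁻¹) * (transvecHom ξ f hfξ a)⁻¹ := by
    simp only [map_mul, map_inv]
    group
  rw [e, hτ.uop_conj, inv_mul_transvecHom_mul g hfξ h', ← hfix]
  set c : k := (a⁻¹ * b).toAdd with hcdef
  have e2 : transvecHom ((↑g⁻¹ : Matrix n n k).mulVec ξ) (Matrix.vecMul f (g : Matrix n n k)) h'
        (a⁻¹ * b) * transvecHom ξ f hfξ (a⁻¹ * b)⁻¹
      = j (lower (Matrix.vecMul f (g : Matrix n n k) ⬝ᵥ ξ * c) *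
        upper (f ⬝ᵥ (↑g⁻¹ : Matrix n n k).mulVec ξ * (-c))) := by
    refine Eq.trans ?_ (map_mul j _ _).symm
    rw [hl, hu]
    rfl
  rw [e2]
  refine trace_eq_of_apply_ne_zero (φ.comp j) hτ ?_
  simpa using And.intro hβ' hc'

end Rigidity

/-! ### Factorization and polar decomposition of operators. -/

section PolarDecomposition

variable {X K F : Type*} [AddCommGroup X] [Module ℂ X]
  [NormedAddCommGroup K] [InnerProductSpace ℂ K] [CompleteSpace K]
  [NormedAddCommGroup F] [InnerProductSpace ℂ F]

/-- Operators that agree on the range of a linear map and on its orthogonal complement agree. -/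
theorem ext_of_range_of_orthogonal (e : X →ₗ[ℂ] K) {V W : K →L[ℂ] F}
    (h : ∀ x, V (e x) = W (e x)) (h' : ∀ v, (∀ x, ⟪e x, v⟫_ℂ = 0) → V v = W v) : V = W := by
  let R : Submodule ℂ K := (LinearMap.range e).topologicalClosure
  have hRc : IsClosed (R : Set K) := Submodule.isClosed_topologicalClosure _
  have : CompleteSpace R := hRc.completeSpace_coe
  have h1 : R ≤ LinearMap.eqLocus V.toLinearMap W.toLinearMap := by
    refine Submodule.topologicalClosure_minimal _ ?_ (isClosed_eq V.continuous W.continuous)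
    rintro _ ⟨x, rfl⟩
    exact h x
  ext v
  have h2 : V (R.starProjection v) = W (R.starProjection v) :=
    h1 (Submodule.starProjection_apply_mem R v)
  have h3 : V (v - R.starProjection v) = W (v - R.starProjection v) := by
    refine h' _ fun x => ?_
    exact (Submodule.mem_orthogonal _ _).1 (Submodule.sub_starProjection_mem_orthogonal v) _
      (Submodule.le_topologicalClosure _ ⟨x, rfl⟩)
  rw [map_sub, map_sub, h2] at h3
  exact sub_left_injective h3

variable [CompleteSpace F]

/-- A linear map `f` dominated by `e` factors through `e` by a bounded operator vanishing on the
orthogonal complement of the range of `e`. -/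
theorem exists_factor_of_norm_le (f : X →ₗ[ℂ] F) (e : X →ₗ[ℂ] K) (c : ℝ)
    (h : ∀ x, ‖f x‖ ≤ c * ‖e x‖) :
    ∃ V : K →L[ℂ] F, (∀ x, V (e x) = f x) ∧ ∀ v, (∀ x, ⟪e x, v⟫_ℂ = 0) → V v = 0 := by
  let W : Submodule ℂ K := (LinearMap.range e).topologicalClosure
  have hWc : IsClosed (W : Set K) := Submodule.isClosed_topologicalClosure _
  have : CompleteSpace W := hWc.completeSpace_coe
  have hmem : ∀ x, e x ∈ W := fun x => Submodule.le_topologicalClosure _ ⟨x, rfl⟩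
  let e' : X →ₗ[ℂ] W := e.codRestrict W hmem
  have hd : DenseRange e' := by
    intro w
    rw [closure_subtype]
    have h1 : (Subtype.val '' Set.range e' : Set K) = LinearMap.range e := by
      ext v
      constructor
      · rintro ⟨_, ⟨x, rfl⟩, rfl⟩
        exact ⟨x, rfl⟩
      · rintro ⟨x, rfl⟩
        exact ⟨e' x, ⟨x, rfl⟩, rfl⟩
    rw [h1]
    exact w.2
  refine ⟨(f.extendOfNorm e').comp W.orthogonalProjectionOnto, fun x => ?_, fun v hv => ?_⟩
  · have h1 : W.orthogonalProjectionOnto (e x) = e' x :=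
      Submodule.orthogonalProjectionOnto_mem_subspace_eq_self (e' x)
    rw [ContinuousLinearMap.comp_apply, h1]
    exact LinearMap.extendOfNorm_eq hd ⟨c, h⟩ x
  · have h1 : v ∈ Wᗮ := by
      change v ∈ (LinearMap.range e).topologicalClosureᗮ
      rw [Submodule.orthogonal_closure]
      rintro _ ⟨x, rfl⟩
      exact hv x
    rw [ContinuousLinearMap.comp_apply,
      Submodule.orthogonalProjectionOnto_apply_of_mem_orthogonal h1, map_zero]

open ContinuousLinearMap InnerProduct in
/-- Polar decomposition: the partial isometry of an operator inherits its intertwining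
relations and its kernel. -/
theorem exists_polar (C : K →L[ℂ] F) : ∃ V : K →L[ℂ] F, V ∘L V† ∘L V = V ∧
    (∀ v, C v = 0 ↔ V v = 0) ∧
    ∀ (y : K →L[ℂ] K) (z : F →L[ℂ] F), y * (C† ∘L C) = (C† ∘L C) * y → C ∘L y = z ∘L C →
      V ∘L y = z ∘L V := by
  set A : K →L[ℂ] K := C† ∘L C with hA
  have hA0 : 0 ≤ A := by
    rw [ContinuousLinearMap.nonneg_iff_isPositive]
    exact isPositive_adjoint_comp_self C
  -- `S = |C|` has the same norms as `C`, so `S u ↦ C u` extends to the partial isometry `V`, set to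
  -- zero on `ker S`, the complement of the range of `S`.
  set S : K →L[ℂ] K := CFC.sqrt A with hS
  have hSS : S * S = A := CFC.sqrt_mul_sqrt_self A hA0
  have hSa : S† = S := (CFC.sqrt_nonneg A).isSelfAdjoint
  have hinner : ∀ u v, ⟪S u, S v⟫_ℂ = ⟪C u, C v⟫_ℂ := fun u v => by
    rw [← adjoint_inner_right, hSa, ← adjoint_inner_right C]
    exact congrArg (fun T : K →L[ℂ] K => ⟪u, T v⟫_ℂ) hSS
  have hnorm : ∀ u, ‖S u‖ = ‖C u‖ := fun u => by
    have h1 := hinner u u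
    rw [inner_self_eq_norm_sq_to_K, inner_self_eq_norm_sq_to_K] at h1
    exact (sq_eq_sq₀ (norm_nonneg _) (norm_nonneg _)).1 (by exact_mod_cast h1)
  have hker : ∀ v, (∀ x, ⟪S.toLinearMap x, v⟫_ℂ = 0) ↔ S v = 0 := fun v => by
    constructor
    · intro h
      have h1 := h (S v)
      change ⟪S (S v), v⟫_ℂ = 0 at h1
      rw [← adjoint_inner_right, hSa] at h1
      exact inner_self_eq_zero.1 h1
    · intro h x
      change ⟪S x, v⟫_ℂ = 0
      rw [← adjoint_inner_right, hSa, h, inner_zero_right]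
  obtain ⟨V, hV, hV0⟩ := exists_factor_of_norm_le C.toLinearMap S.toLinearMap 1
    (fun x => by simpa using (hnorm x).symm.le)
  replace hV : ∀ x, V (S x) = C x := hV
  replace hV0 : ∀ v, S v = 0 → V v = 0 := fun v hv => hV0 v ((hker v).2 hv)
  have hVV : ∀ v, (V†) (V (S v)) = S v := fun v => by
    refine ext_inner_right ℂ fun w => ?_
    rw [adjoint_inner_left]
    suffices h : (innerSL ℂ (V (S v))).comp V = innerSL ℂ (S v) from
      congrArg (fun T : K →L[ℂ] ℂ => T w) h
    refine ext_of_range_of_orthogonal S.toLinearMap (fun x => ?_) (fun u hu => ?_)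
    · change ⟪V (S v), V (S x)⟫_ℂ = ⟪S v, S x⟫_ℂ
      rw [hV, hV, hinner]
    · change ⟪V (S v), V u⟫_ℂ = ⟪S v, u⟫_ℂ
      rw [hV0 u ((hker u).1 hu), inner_zero_right]
      exact (hu v).symm
  have hCS : ∀ v, C v = 0 ↔ S v = 0 := fun v => by
    rw [← norm_eq_zero, ← hnorm, norm_eq_zero]
  refine ⟨V, ?_, fun v => ?_, fun y z hy hyz => ?_⟩
  · refine ext_of_range_of_orthogonal S.toLinearMap (fun x => ?_) (fun u hu => ?_)
    · exact congrArg V (hVV x)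
    · have h1 : V u = 0 := hV0 u ((hker u).1 hu)
      simp [h1]
  · rw [hCS]
    refine ⟨hV0 v, fun h => (hker v).1 fun x => ?_⟩
    change ⟪S x, v⟫_ℂ = 0
    rw [← hVV, adjoint_inner_left, h, inner_zero_right]
  -- An operator commuting with `C†C` commutes with its square root by functional calculus.
  · have hyS : S * y = y * S := by
      rw [hS, CFC.sqrt_eq_cfc]
      exact Commute.cfc_nnreal (show Commute A y from hy.symm) _
    have hyS' : ∀ v, S (y v) = y (S v) := fun v => congrArg (fun T : K →L[ℂ] K => T v) hyS
    refine ext_of_range_of_orthogonal S.toLinearMap (fun x => ?_) (fun u hu => ?_)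
    · change V (y (S x)) = z (V (S x))
      rw [← hyS', hV, hV]
      exact congrArg (fun T : K →L[ℂ] F => T x) hyz
    · have h1 : S u = 0 := (hker u).1 hu
      change V (y u) = z (V u)
      rw [hV0 u h1, map_zero]
      refine hV0 _ ?_
      rw [hyS', h1, map_zero]

end PolarDecomposition

/-! ### Amplifications and orthogonal families of partial isometries. -/

section Amplification

variable {ι E F : Type*} [NormedAddCommGroup E] [InnerProductSpace ℂ E]
  [NormedAddCommGroup F] [InnerProductSpace ℂ F]

open ContinuousLinearMap InnerProduct

theorem amp_mul (S T : E →L[ℂ] E) : amp ι (S * T) = amp ι S * amp ι T := rfl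

theorem amp_add (S T : E →L[ℂ] F) : amp ι (S + T) = amp ι S + amp ι T := rfl

theorem amp_smul (c : ℂ) (T : E →L[ℂ] F) : amp ι (c • T) = c • amp ι T := rfl

theorem amp_single [DecidableEq ι] (T : E →L[ℂ] F) (i : ι) (v : E) :
    amp ι T (lp.single 2 i v) = lp.single 2 i (T v) := by
  refine lp.ext (funext fun j => ?_)
  rw [amp_apply]
  by_cases h : j = i
  · subst h
    simp
  · simp [h]

/-- The operator `v ↦ (Vᵢ v)ᵢ` into an `ℓ²`-sum. -/
def rowOp (V : ι → E →L[ℂ] F) (hs : ∀ v, Summable fun i => ‖V i v‖ ^ 2)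
    (hV : ∀ v, ∑' i, ‖V i v‖ ^ 2 ≤ ‖v‖ ^ 2) : E →L[ℂ] lp (fun _ : ι => F) 2 :=
  LinearMap.mkContinuous
    { toFun := fun v => toLp (fun i => V i v) (hs v)
      map_add' := fun v w => by
        refine lp.ext (funext fun i => ?_)
        simp
      map_smul' := fun c v => by
        refine lp.ext (funext fun i => ?_)
        simp } 1 (fun v => by
      refine (sq_le_sq₀ (norm_nonneg _) (by positivity)).1 ?_
      rw [lp_norm_sq_eq_tsum, one_mul]
      exact hV v)

variable [CompleteSpace E] [CompleteSpace F]

theorem adjoint_amp (T : E →L[ℂ] F) : (amp ι T)† = amp ι (T†) := by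
  refine ((eq_adjoint_iff _ _).2 fun x y => ?_).symm
  rw [lp.inner_eq_tsum, lp.inner_eq_tsum]
  simp only [amp_apply, adjoint_inner_left]

/-- The Bessel inequality for partial isometries with orthogonal initial spaces. -/
theorem sum_norm_sq_le_of_partialIsometry {V : ι → E →L[ℂ] F}
    (h : ∀ i, V i ∘L (V i)† ∘L V i = V i) (h' : ∀ i j, i ≠ j → V i ∘L (V j)† = 0) (v : E)
    (s : Finset ι) : ∑ i ∈ s, ‖V i v‖ ^ 2 ≤ ‖v‖ ^ 2 := by
  classical
  have hVi : ∀ i j, i ≠ j → ∀ w, V i (((V j)†) w) = 0 := fun i j hij w =>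
    congrArg (fun T : F →L[ℂ] F => T w) (h' i j hij)
  have hVV : ∀ i w, V i (((V i)†) (V i w)) = V i w := fun i w =>
    congrArg (fun T : E →L[ℂ] F => T w) (h i)
  -- `w` is the projection of `v` onto the sum of the initial spaces.
  set w : E := ∑ i ∈ s, ((V i)†) (V i v) with hw
  have h1 : ∀ i ∈ s, V i w = V i v := fun i hi => by
    rw [hw, map_sum, Finset.sum_eq_single_of_mem i hi fun j _ hj => hVi i j hj.symm _, hVV]
  have h2 : ∀ u, ⟪w, u⟫_ℂ = ∑ i ∈ s, ⟪V i v, V i u⟫_ℂ := fun u => by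
    rw [hw, sum_inner]
    exact Finset.sum_congr rfl fun i _ => adjoint_inner_left _ _ _
  have h3 : ⟪w, w⟫_ℂ = ((∑ i ∈ s, ‖V i v‖ ^ 2 : ℝ) : ℂ) := by
    rw [h2]
    push_cast
    refine Finset.sum_congr rfl fun i hi => ?_
    rw [h1 i hi, inner_self_eq_norm_sq_to_K]
    rfl
  have h4 : ⟪w, v⟫_ℂ = ⟪w, w⟫_ℂ := by
    rw [h2, h2]
    exact Finset.sum_congr rfl fun i hi => by rw [h1 i hi]
  have h5 : ‖w‖ ^ 2 = ∑ i ∈ s, ‖V i v‖ ^ 2 := by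
    rw [inner_self_eq_norm_sq_to_K] at h3
    exact Complex.ofReal_injective (by simpa using h3)
  have h6 : ‖w‖ ^ 2 ≤ ‖w‖ * ‖v‖ := by
    have := norm_inner_le_norm (𝕜 := ℂ) w v
    rw [h4, inner_self_eq_norm_sq_to_K] at this
    simpa using this
  rw [← h5]
  rcases (norm_nonneg w).eq_or_lt with h7 | h7
  · rw [← h7, zero_pow two_ne_zero]
    positivity
  · have : ‖w‖ ≤ ‖v‖ := by
      rw [sq] at h6
      exact le_of_mul_le_mul_left h6 h7
    gcongr

end Amplification

open ContinuousLinearMap InnerProduct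

/-! ### The left regular representation. -/

section RegularRepresentation

variable {Γ : Type*} [Group Γ]

@[simp]
theorem leftRegular_apply (g : Γ) (f : EllTwo Γ) (h : Γ) :
    leftRegular g f h = f (g⁻¹ * h) := rfl

theorem leftRegular_inv_apply (g : Γ) (f : EllTwo Γ) :
    leftRegular g (leftRegular g⁻¹ f) = f := by
  refine lp.ext (funext fun h => ?_)
  simp

theorem adjoint_leftRegular (g : Γ) : (leftRegular g)† = leftRegular g⁻¹ := by
  refine ((eq_adjoint_iff _ _).2 fun u v => ?_).symm
  conv_rhs => rw [← leftRegular_inv_apply g u]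
  exact ((leftTranslation g).inner_map_map _ _).symm

theorem leftRegular_single [DecidableEq Γ] (g h : Γ) :
    leftRegular g (lp.single 2 h (1 : ℂ)) = lp.single 2 (g * h) (1 : ℂ) := by
  refine lp.ext (funext fun x => ?_)
  rw [leftRegular_apply, lp.single_apply, lp.single_apply, Pi.single_apply, Pi.single_apply]
  simp only [inv_mul_eq_iff_eq_mul]

/-- An operator commuting with the left regular representation commutes with `L(Γ)`. -/
theorem groupVNA_comp_eq {T : EllTwo Γ →L[ℂ] EllTwo Γ}
    (h : ∀ g, T ∘L leftRegular g = leftRegular g ∘L T) (x : (groupVNA Γ).toStarSubalgebra) :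
    T ∘L (x : EllTwo Γ →L[ℂ] EllTwo Γ) = (x : EllTwo Γ →L[ℂ] EllTwo Γ) ∘L T := by
  have hx : (x : EllTwo Γ →L[ℂ] EllTwo Γ) ∈ StarSubalgebra.centralizer ℂ
    (StarSubalgebra.centralizer ℂ (Set.range (leftRegular (Γ := Γ))) : Set _) := x.2
  refine ((StarSubalgebra.mem_centralizer_iff ℂ).1 hx T ?_).1
  refine (StarSubalgebra.mem_centralizer_iff ℂ).2 ?_
  rintro _ ⟨g, rfl⟩
  refine ⟨(h g).symm, ?_⟩
  rw [star_eq_adjoint, adjoint_leftRegular]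
  exact (h g⁻¹).symm

end RegularRepresentation

/-! ### Intertwiners with the regular representation. -/

section Intertwiners

variable {H : Type*} [NormedAddCommGroup H] [InnerProductSpace ℂ H] [CompleteSpace H]
  {M : VonNeumannAlgebra H} {Γ : Type*} [Group Γ]

/-- `C` intertwines the part of `φ` under `p` with the left regular representation. -/
structure IsIntertwiner (φ : Γ →* unitary M.toStarSubalgebra) (p : M.toStarSubalgebra)
    (C : H →L[ℂ] EllTwo Γ) : Prop where
  comp_uop : ∀ g, C ∘L (uop φ g : H →L[ℂ] H) = leftRegular g ∘L C
  comp_proj : C ∘L (p : H →L[ℂ] H) = C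

variable {φ : Γ →* unitary M.toStarSubalgebra} {p : M.toStarSubalgebra}

theorem adjoint_coe (x : M.toStarSubalgebra) :
    (x : H →L[ℂ] H)† = ((star x : M.toStarSubalgebra) : H →L[ℂ] H) := rfl

theorem adjoint_comp_of_comp_uop {K : Type*} [NormedAddCommGroup K] [InnerProductSpace ℂ K]
    [CompleteSpace K] {T : H →L[ℂ] K} {A : Γ → K →L[ℂ] K} (hA : ∀ g, (A g)† = A g⁻¹)
    (h : ∀ g, T ∘L (uop φ g : H →L[ℂ] H) = A g ∘L T) (g : Γ) :
    T† ∘L A g = (uop φ g : H →L[ℂ] H) ∘L T† := by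
  have h := congrArg adjoint (h g⁻¹)
  rw [adjoint_comp, adjoint_comp, hA, inv_inv, adjoint_coe, uop_inv, star_star] at h
  exact h.symm

theorem proj_comp_adjoint_of_comp_proj {K : Type*} [NormedAddCommGroup K] [InnerProductSpace ℂ K]
    [CompleteSpace K] {T : H →L[ℂ] K} (hp : IsStarProjection p)
    (h : T ∘L (p : H →L[ℂ] H) = T) : (p : H →L[ℂ] H) ∘L T† = T† := by
  have h := congrArg adjoint h
  rwa [adjoint_comp, adjoint_coe, hp.2.star_eq] at h

namespace IsIntertwiner

theorem adjoint_comp {C : H →L[ℂ] EllTwo Γ} (hC : IsIntertwiner φ p C) (g : Γ) :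
    C† ∘L leftRegular g = (uop φ g : H →L[ℂ] H) ∘L C† :=
  adjoint_comp_of_comp_uop adjoint_leftRegular hC.comp_uop g

theorem proj_comp_adjoint {C : H →L[ℂ] EllTwo Γ} (hC : IsIntertwiner φ p C)
    (hp : IsStarProjection p) : (p : H →L[ℂ] H) ∘L C† = C† :=
  proj_comp_adjoint_of_comp_proj hp hC.comp_proj

/-- `C D†` commutes with each `λ(g)`, hence with `λ(Γ)''`. Through this fact elements of `L(Γ)`, not
only group elements, pass across intertwiners. -/
theorem comp_adjoint_comp {C D : H →L[ℂ] EllTwo Γ} (hC : IsIntertwiner φ p C)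
    (hD : IsIntertwiner φ p D) (x : (groupVNA Γ).toStarSubalgebra) :
    (C ∘L D†) ∘L (x : EllTwo Γ →L[ℂ] EllTwo Γ) = (x : EllTwo Γ →L[ℂ] EllTwo Γ) ∘L (C ∘L D†) := by
  refine groupVNA_comp_eq (fun g => ?_) x
  rw [comp_assoc, hD.adjoint_comp, ← comp_assoc, hC.comp_uop, comp_assoc]

theorem comp_commutant {C : H →L[ℂ] EllTwo Γ} (hC : IsIntertwiner φ p C) {y : H →L[ℂ] H}
    (hy : y ∈ M.commutant) : IsIntertwiner φ p (C ∘L y) := by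
  have h : ∀ x : M.toStarSubalgebra, y ∘L (x : H →L[ℂ] H) = (x : H →L[ℂ] H) ∘L y := fun x =>
    ContinuousLinearMap.ext fun v => (commutant_apply hy x v).symm
  constructor
  · intro g
    rw [comp_assoc, h, ← comp_assoc, hC.comp_uop, comp_assoc]
  · rw [comp_assoc, h, ← comp_assoc, hC.comp_proj]

/-- The partial isometry in the polar decomposition of an intertwiner is an intertwiner. -/
theorem exists_polar {C : H →L[ℂ] EllTwo Γ} (hC : IsIntertwiner φ p C)
    (hp : IsStarProjection p) : ∃ V : H →L[ℂ] EllTwo Γ, IsIntertwiner φ p V ∧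
      V ∘L V† ∘L V = V ∧ ∀ v, C v = 0 ↔ V v = 0 := by
  obtain ⟨V, h1, h2, h3⟩ := VNRigidity.exists_polar C
  refine ⟨V, ⟨fun g => h3 _ _ ?_ (hC.comp_uop g), ?_⟩, h1, h2⟩
  · change (uop φ g : H →L[ℂ] H) ∘L (C† ∘L C) = (C† ∘L C) ∘L (uop φ g : H →L[ℂ] H)
    rw [comp_assoc, hC.comp_uop, ← comp_assoc, ← comp_assoc, hC.adjoint_comp]
  · refine h3 _ 1 ?_ hC.comp_proj
    change (p : H →L[ℂ] H) ∘L (C† ∘L C) = (C† ∘L C) ∘L (p : H →L[ℂ] H)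
    rw [comp_assoc, hC.comp_proj, ← comp_assoc, hC.proj_comp_adjoint hp]

end IsIntertwiner

end Intertwiners

/-! ### The coefficient operator attached to the trace. -/

section CoefficientOperator

variable {H : Type*} [NormedAddCommGroup H] [InnerProductSpace ℂ H] [CompleteSpace H]
  {M : VonNeumannAlgebra H} {τ : M.toStarSubalgebra →ₗ[ℂ] ℂ}

/-- A normal trace is dominated by a vector of an amplification of `H`. -/
theorem IsFaithfulNormalTrace.exists_amp_bound (hτ : IsFaithfulNormalTrace M τ) :
    ∃ θ : lp (fun _ : ℕ => H) 2, ∀ x : M.toStarSubalgebra,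
      (τ (star x * x)).re ≤ ‖amp ℕ (x : H →L[ℂ] H) θ‖ ^ 2 := by
  obtain ⟨ξ, η, hξ, hη, h⟩ := hτ.normal
  -- Termwise, `Re⟨xξₙ, xηₙ⟩ ≤ ‖x(ξₙ + ηₙ)‖²`, so the sum of the two representing vectors dominates
  -- the trace.
  refine ⟨toLp ξ hξ + toLp η hη, fun x => ?_⟩
  have h1 := Complex.hasSum_re (h (star x * x))
  have h2 : ∀ n, (⟪ξ n, ((star x * x : M.toStarSubalgebra) : H →L[ℂ] H) (η n)⟫_ℂ).re
      ≤ ‖amp ℕ (x : H →L[ℂ] H) (toLp ξ hξ + toLp η hη) n‖ ^ 2 := by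
    intro n
    have e : ⟪ξ n, ((star x * x : M.toStarSubalgebra) : H →L[ℂ] H) (η n)⟫_ℂ
        = ⟪(x : H →L[ℂ] H) (ξ n), (x : H →L[ℂ] H) (η n)⟫_ℂ :=
      adjoint_inner_right (x : H →L[ℂ] H) _ _
    rw [e]
    change _ ≤ ‖(x : H →L[ℂ] H) (ξ n + η n)‖ ^ 2
    rw [map_add]
    have e1 := norm_add_sq (𝕜 := ℂ) ((x : H →L[ℂ] H) (ξ n)) ((x : H →L[ℂ] H) (η n))
    have e2 := norm_sub_sq (𝕜 := ℂ) ((x : H →L[ℂ] H) (ξ n)) ((x : H →L[ℂ] H) (η n))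
    simp only [RCLike.re_to_complex] at e1 e2
    nlinarith [sq_nonneg ‖(x : H →L[ℂ] H) (ξ n) - (x : H →L[ℂ] H) (η n)‖,
      sq_nonneg ‖(x : H →L[ℂ] H) (ξ n) + (x : H →L[ℂ] H) (η n)‖]
  rw [lp_norm_sq_eq_tsum, ← h1.tsum_eq]
  exact Summable.tsum_le_tsum h2 h1.summable (summable_sq_of_lp _)

variable {Γ : Type*} [Group Γ] {φ : Γ →* unitary M.toStarSubalgebra} {p : M.toStarSubalgebra}

theorem trace_coefficient_eq_zero (hτ : IsFaithfulNormalTrace M τ) (hp : IsStarProjection p)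
    (htr : ∀ g, g ≠ 1 → τ (uop φ g * p) = 0) {g h : Γ} (hgh : g ≠ h) :
    τ (star (uop φ g * p) * (uop φ h * p)) = 0 := by
  rw [star_mul, hp.2.star_eq, ← uop_inv, mul_assoc, hτ.tracial, mul_assoc, mul_assoc, hp.1.eq,
    ← mul_assoc, ← uop_mul]
  exact htr _ fun h' => hgh (inv_mul_eq_one.1 h')

theorem trace_coefficient_self (hp : IsStarProjection p) (g : Γ) :
    τ (star (uop φ g * p) * (uop φ g * p)) = τ p := by
  rw [star_mul, hp.2.star_eq, mul_assoc, ← mul_assoc (star _), star_uop_mul_self, one_mul, hp.1.eq]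

/-- The Bessel inequality for the orthogonal family `φ(g) p`. -/
theorem sum_norm_sq_trace_le (hτ : IsFaithfulNormalTrace M τ) (hp : IsStarProjection p)
    (htr : ∀ g, g ≠ 1 → τ (uop φ g * p) = 0) (x : M.toStarSubalgebra) (s : Finset Γ) :
    ∑ g ∈ s, ‖τ (star (uop φ g * p) * x)‖ ^ 2 ≤ (τ (star x * x)).re := by
  classical
  set c : Γ → ℂ := fun g => τ (star (uop φ g * p) * x) with hc
  set y : M.toStarSubalgebra := ∑ g ∈ s, c g • (uop φ g * p) with hy
  set A : ℝ := ∑ g ∈ s, ‖c g‖ ^ 2 with hA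
  have hy' : ∀ z, τ (star y * z) = ∑ g ∈ s, star (c g) * τ (star (uop φ g * p) * z) := fun z => by
    rw [hy, star_sum, Finset.sum_mul, map_sum]
    refine Finset.sum_congr rfl fun g _ => ?_
    rw [star_smul, smul_mul_assoc, map_smul, smul_eq_mul]
  have hself : ∀ z : ℂ, star z * z = ((‖z‖ ^ 2 : ℝ) : ℂ) := fun z => by
    rw [Complex.star_def, mul_comm, Complex.mul_conj, Complex.normSq_eq_norm_sq]
  have h1 : τ (star y * x) = (A : ℂ) := by
    rw [hy', hA, Complex.ofReal_sum]
    exact Finset.sum_congr rfl fun g _ => hself _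
  have h2 : τ (star y * y) = (A : ℂ) * τ p := by
    rw [hy', hA, Complex.ofReal_sum, Finset.sum_mul]
    refine Finset.sum_congr rfl fun g hg => ?_
    have : τ (star (uop φ g * p) * y) = c g * τ p := by
      rw [hy, Finset.mul_sum, map_sum, Finset.sum_eq_single_of_mem g hg]
      · rw [mul_smul_comm, map_smul, smul_eq_mul, trace_coefficient_self hp]
      · intro h _ hne
        rw [mul_smul_comm, map_smul, trace_coefficient_eq_zero hτ hp htr hne.symm, smul_zero]
    rw [this, ← mul_assoc, hself]
  -- The family has `τ`-norm squared `τ p`; the bound `τ p ≤ 1` allows Bessel's inequality without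
  -- normalization.
  have hp1 : (τ p).re ≤ 1 := by
    have h3 := hτ.nonneg (1 - p)
    have h4 : star (1 - p) * (1 - p) = 1 - p := by
      rw [star_sub, star_one, hp.2.star_eq, mul_sub, sub_mul, sub_mul, hp.1.eq]
      simp
    rw [h4, map_sub, hτ.map_one] at h3
    have := (Complex.le_def.1 h3).1
    simpa using this
  have h0 : 0 ≤ (τ (star x * x)).re := (Complex.le_def.1 (hτ.nonneg x)).1
  have h3 := hτ.norm_sq_le y x
  rw [h1, h2, Complex.norm_real, Complex.re_ofReal_mul, Real.norm_eq_abs, sq_abs] at h3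
  have hA0 : 0 ≤ A := Finset.sum_nonneg fun g _ => by positivity
  rcases hA0.eq_or_lt with h4 | h4
  · rw [← h4]
    exact h0
  · refine le_of_mul_le_mul_left (a := A) ?_ h4
    calc A * A = A ^ 2 := (sq A).symm
      _ ≤ A * (τ p).re * (τ (star x * x)).re := h3
      _ ≤ A * 1 * (τ (star x * x)).re := by gcongr
      _ = A * (τ (star x * x)).re := by ring

/-- The operator `x ↦ (τ(p φ(g)* x))_g`, realized on an amplification of `H`. -/
theorem exists_coefficientOperator (hτ : IsFaithfulNormalTrace M τ) (hp : IsStarProjection p)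
    (hcomm : ∀ g, Commute p (uop φ g)) (htr : ∀ g, g ≠ 1 → τ (uop φ g * p) = 0) :
    ∃ (θ : lp (fun _ : ℕ => H) 2) (B : lp (fun _ : ℕ => H) 2 →L[ℂ] EllTwo Γ),
      (∀ (x : M.toStarSubalgebra) (g : Γ),
        B (amp ℕ (x : H →L[ℂ] H) θ) g = τ (star (uop φ g * p) * x)) ∧
      (∀ g, B ∘L amp ℕ (uop φ g : H →L[ℂ] H) = leftRegular g ∘L B) ∧
      B ∘L amp ℕ (p : H →L[ℂ] H) = B := by
  obtain ⟨θ, hθ⟩ := hτ.exists_amp_bound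
  have hs : ∀ x : M.toStarSubalgebra, Summable fun g => ‖τ (star (uop φ g * p) * x)‖ ^ 2 :=
    fun x => summable_of_sum_le (fun g => by positivity) (sum_norm_sq_trace_le hτ hp htr x)
  let f : M.toStarSubalgebra →ₗ[ℂ] EllTwo Γ :=
    { toFun := fun x => toLp (fun g => τ (star (uop φ g * p) * x)) (hs x)
      map_add' := fun x y => by
        refine lp.ext (funext fun g => ?_)
        simp [mul_add]
      map_smul' := fun c x => by
        refine lp.ext (funext fun g => ?_)
        simp }
  have hf : ∀ x g, f x g = τ (star (uop φ g * p) * x) := fun x g => rfl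
  let e : M.toStarSubalgebra →ₗ[ℂ] lp (fun _ : ℕ => H) 2 :=
    { toFun := fun x => amp ℕ (x : H →L[ℂ] H) θ
      map_add' := fun x y => rfl
      map_smul' := fun c x => rfl }
  have hbound : ∀ x, ‖f x‖ ≤ 1 * ‖e x‖ := fun x => by
    rw [one_mul]
    refine (sq_le_sq₀ (norm_nonneg _) (norm_nonneg _)).1 ?_
    rw [lp_norm_sq_eq_tsum]
    exact ((hs x).tsum_le_of_sum_le (sum_norm_sq_trace_le hτ hp htr x)).trans (hθ x)
  obtain ⟨B, hB, hB0⟩ := exists_factor_of_norm_le f e 1 hbound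
  -- The subspace `Mθ` is invariant under the self-adjoint algebra `M`, so its orthogonal
  -- complement, on which `B` vanishes, is too. The intertwining relations need checking only on
  -- `Mθ`.
  have horth : ∀ (y : M.toStarSubalgebra) (v : lp (fun _ : ℕ => H) 2), (∀ x, ⟪e x, v⟫_ℂ = 0) →
      B (amp ℕ (y : H →L[ℂ] H) v) = 0 := by
    intro y v hv
    refine hB0 _ fun x => ?_
    rw [← adjoint_inner_left, adjoint_amp]
    exact hv (star y * x)
  have hmul : ∀ y x : M.toStarSubalgebra, B (amp ℕ (y : H →L[ℂ] H) (e x)) = f (y * x) :=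
    fun y x => hB (y * x)
  refine ⟨θ, B, fun x g => ?_, fun g => ?_, ?_⟩
  · rw [← hf, ← hB]
    rfl
  · refine ext_of_range_of_orthogonal e (fun x => ?_) (fun v hv => ?_)
    · rw [comp_apply, comp_apply, hmul, hB]
      refine lp.ext (funext fun h => ?_)
      rw [leftRegular_apply, hf, hf, uop_mul, uop_inv]
      simp only [star_mul, star_star, mul_assoc]
    · rw [comp_apply, comp_apply, horth _ v hv, hB0 v hv, map_zero]
  · refine ext_of_range_of_orthogonal e (fun x => ?_) (fun v hv => ?_)
    · rw [comp_apply, hmul, hB]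
      refine lp.ext (funext fun h => ?_)
      rw [hf, hf, ← mul_assoc, ← (hcomm h).eq, star_mul, hp.2.star_eq, mul_assoc _ p p, hp.1.eq]
    · rw [comp_apply, horth _ v hv, hB0 v hv]

end CoefficientOperator

open ContinuousLinearMap InnerProduct

/-! ### Normality of compressed amplifications. -/

section Normality

variable {H : Type*} [NormedAddCommGroup H] [InnerProductSpace ℂ H]
  {K : Type*} [NormedAddCommGroup K] [InnerProductSpace ℂ K]

theorem summable_sq_apply_prod {ι : Type*} (T : H →L[ℂ] lp (fun _ : ι => K) 2) {ξ : ℕ → H}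
    (hξ : Summable fun n => ‖ξ n‖ ^ 2) :
    Summable fun a : ℕ × ι => ‖T (ξ a.1) a.2‖ ^ 2 := by
  refine (summable_prod_of_nonneg fun a => by positivity).2
    ⟨fun n => summable_sq_of_lp (T (ξ n)), ?_⟩
  simp only [← lp_norm_sq_eq_tsum]
  exact summable_sq_map (fun _ => le_refl ‖T‖) hξ

variable [CompleteSpace H] [CompleteSpace K]

/-- The index set of the families representing a normal functional may be arbitrary. -/
theorem isNormalFunctional_of_hasSum {N : VonNeumannAlgebra K} {f : N.toStarSubalgebra → ℂ}
    {α : Type*} {ξ η : α → K} (hξ : Summable fun a => ‖ξ a‖ ^ 2)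
    (hη : Summable fun a => ‖η a‖ ^ 2)
    (h : ∀ x : N.toStarSubalgebra, HasSum (fun a => ⟪ξ a, (x : K →L[ℂ] K) (η a)⟫_ℂ) (f x)) :
    IsNormalFunctional N f := by
  -- Only countably many `ξ a` are nonzero. These are reindexed by `ℕ` and the remaining places are
  -- filled with zeros.
  set A : Set α := Function.support fun a => ‖ξ a‖ ^ 2 with hA
  have : Countable A := hξ.countable_support
  obtain ⟨e, he⟩ := exists_injective_nat A
  have hval : ∀ (u : α → K) (a : A), Function.extend e (fun a : A => u a) 0 (e a) = u a :=
    fun u a => he.extend_apply _ _ _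
  have hval' : ∀ (u : α → K) (n : ℕ), n ∉ Set.range e →
      Function.extend e (fun a : A => u a) 0 n = 0 := fun u n hn =>
    Function.extend_apply' _ _ _ fun ⟨a, ha⟩ => hn ⟨a, ha⟩
  have hsum : ∀ u : α → K, Summable (fun a => ‖u a‖ ^ 2) →
      Summable fun n => ‖Function.extend e (fun a : A => u a) 0 n‖ ^ 2 := fun u hu => by
    refine (he.summable_iff fun n hn => ?_).1 ?_
    · rw [hval' u n hn]
      simp
    · have : ((fun n => ‖Function.extend e (fun a : A => u a) 0 n‖ ^ 2) ∘ e)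
          = fun a : A => ‖u a‖ ^ 2 := funext fun a => by
        rw [Function.comp_apply, hval]
      rw [this]
      exact hu.comp_injective Subtype.val_injective
  refine ⟨_, _, hsum ξ hξ, hsum η hη, fun x => ?_⟩
  refine (he.hasSum_iff fun n hn => ?_).1 ?_
  · rw [hval' ξ n hn, inner_zero_left]
  · have e1 : ((fun n => ⟪Function.extend e (fun a : A => ξ a) 0 n,
        (x : K →L[ℂ] K) (Function.extend e (fun a : A => η a) 0 n)⟫_ℂ) ∘ e)
        = (fun a => ⟪ξ a, (x : K →L[ℂ] K) (η a)⟫_ℂ) ∘ ((↑) : A → α) := funext fun a => by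
      rw [Function.comp_apply, hval, hval]
      rfl
    rw [e1]
    refine (hasSum_subtype_iff_of_support_subset fun a ha => ?_).2 (h x)
    rw [hA, Function.mem_support]
    intro h0
    refine ha ?_
    have : ξ a = 0 := by simpa using h0
    change ⟪ξ a, _⟫_ℂ = 0
    rw [this, inner_zero_left]

/-- Compressions of amplifications are normal. -/
theorem isNormalMap_of_eq_amp {N : VonNeumannAlgebra K} {M : VonNeumannAlgebra H} {ι : Type*}
    (T : H →L[ℂ] lp (fun _ : ι => K) 2) {ψ : N.toStarSubalgebra → M.toStarSubalgebra}
    (h : ∀ x, (ψ x : H →L[ℂ] H) = T† ∘L amp ι (x : K →L[ℂ] K) ∘L T) : IsNormalMap N M ψ := by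
  rintro f ⟨ξ, η, hξ, hη, hf⟩
  refine isNormalFunctional_of_hasSum (summable_sq_apply_prod T hξ) (summable_sq_apply_prod T hη)
    fun x => ?_
  have hsum : Summable fun a : ℕ × ι =>
      ⟪T (ξ a.1) a.2, (x : K →L[ℂ] K) (T (η a.1) a.2)⟫_ℂ := by
    have h1 := summable_sq_map (fun _ => le_refl ‖(x : K →L[ℂ] K)‖) (summable_sq_apply_prod T hη)
    refine Summable.of_norm_bounded ((summable_sq_apply_prod T hξ).add h1) fun a => ?_
    refine (norm_inner_le_norm _ _).trans ?_
    nlinarith [sq_nonneg (‖T (ξ a.1) a.2‖ - ‖(x : K →L[ℂ] K) (T (η a.1) a.2)‖),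
      sq_nonneg (‖T (ξ a.1) a.2‖ + ‖(x : K →L[ℂ] K) (T (η a.1) a.2)‖)]
  have h2 : HasSum (fun n => ⟪ξ n, (ψ x : H →L[ℂ] H) (η n)⟫_ℂ)
      (∑' a : ℕ × ι, ⟪T (ξ a.1) a.2, (x : K →L[ℂ] K) (T (η a.1) a.2)⟫_ℂ) := by
    refine hsum.hasSum.prod_fiberwise fun n => ?_
    rw [h, comp_apply, adjoint_inner_right]
    exact lp.hasSum_inner (T (ξ n)) (amp ι (x : K →L[ℂ] K) (T (η n)))
  have h3 : f (ψ x) = _ := (hf (ψ x)).unique h2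
  rw [Function.comp_apply, h3]
  exact hsum.hasSum

end Normality

/-! ### Embedding the corner in a multiple of the regular representation. -/

section Decomposition

variable {H : Type*} [NormedAddCommGroup H] [InnerProductSpace ℂ H] [CompleteSpace H]
  {M : VonNeumannAlgebra H} {τ : M.toStarSubalgebra →ₗ[ℂ] ℂ}
  {Γ : Type*} [Group Γ] {φ : Γ →* unitary M.toStarSubalgebra} {p : M.toStarSubalgebra}

/-- Restricting to the coordinates turns an intertwiner on the amplification into intertwiners on
`H` itself. -/
theorem isIntertwiner_comp_single {B : lp (fun _ : ℕ => H) 2 →L[ℂ] EllTwo Γ}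
    (hB : ∀ g, B ∘L amp ℕ (uop φ g : H →L[ℂ] H) = leftRegular g ∘L B)
    (hBp : B ∘L amp ℕ (p : H →L[ℂ] H) = B) (n : ℕ) :
    IsIntertwiner φ p (B ∘L lp.singleContinuousLinearMap ℂ (fun _ : ℕ => H) 2 n) := by
  constructor
  · intro g
    ext1 v
    have := congrArg (fun T : lp (fun _ : ℕ => H) 2 →L[ℂ] EllTwo Γ => T (lp.single 2 n v)) (hB g)
    simp only [comp_apply, amp_single] at this
    simpa using this
  · ext1 v
    have := congrArg (fun T : lp (fun _ : ℕ => H) 2 →L[ℂ] EllTwo Γ => T (lp.single 2 n v)) hBp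
    simp only [comp_apply, amp_single] at this
    simpa using this

/-- The intertwiners with the regular representation separate the points of the range of `p`. -/
theorem apply_eq_zero_of_forall_isIntertwiner (hτ : IsFaithfulNormalTrace M τ)
    (hp : IsStarProjection p) (hcomm : ∀ g, Commute p (uop φ g))
    (htr : ∀ g, g ≠ 1 → τ (uop φ g * p) = 0) {v : H}
    (hv : ∀ C : H →L[ℂ] EllTwo Γ, IsIntertwiner φ p C → C v = 0) : (p : H →L[ℂ] H) v = 0 := by
  obtain ⟨θ, B, hB, hBg, hBp⟩ := exists_coefficientOperator hτ hp hcomm htr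
  -- The common kernel is `M'`-invariant because `C ∘ y` is again an intertwiner for `y ∈ M'`, so
  -- its projection `E` lies in `M`. The coefficient operator kills `Eθ`; its coordinate at the
  -- identity gives `τ(pE) = 0`, whence `pE = 0`.
  let N : Submodule ℂ H := ⨅ C : {C : H →L[ℂ] EllTwo Γ // IsIntertwiner φ p C},
    LinearMap.ker C.1.toLinearMap
  have hN : ∀ w, w ∈ N ↔ ∀ C : H →L[ℂ] EllTwo Γ, IsIntertwiner φ p C → C w = 0 := fun w => by
    simp [N, Submodule.mem_iInf]
  have hNc : IsClosed (N : Set H) := by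
    have : (N : Set H) = ⋂ C : {C : H →L[ℂ] EllTwo Γ // IsIntertwiner φ p C},
        {w | C.1 w = 0} := by
      ext w
      simp [hN]
    rw [this]
    exact isClosed_iInter fun C => isClosed_eq C.1.continuous continuous_const
  have : CompleteSpace N := hNc.completeSpace_coe
  let E : M.toStarSubalgebra := ⟨N.starProjection, starProjection_mem N fun y hy w hw =>
    (hN _).2 fun C hC => (hN w).1 hw _ (hC.comp_commutant hy)⟩
  have hEE : E * E = E := Subtype.ext (isStarProjection_starProjection (U := N)).1
  have hE : star E = E := Subtype.ext (isStarProjection_starProjection (U := N)).2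
  have hBE : B ∘L amp ℕ (E : H →L[ℂ] H) = 0 := by
    refine lp.ext_continuousLinearMap (by norm_num) fun n => ?_
    ext1 w
    simp only [comp_apply, lp.singleContinuousLinearMap_apply, amp_single]
    exact (hN _).1 (Submodule.starProjection_apply_mem N w) _ (isIntertwiner_comp_single hBg hBp n)
  have h1 : τ (p * E) = 0 := by
    have h2 := hB E 1
    have h3 : B (amp ℕ (E : H →L[ℂ] H) θ) = 0 :=
      congrArg (fun T : lp (fun _ : ℕ => H) 2 →L[ℂ] EllTwo Γ => T θ) hBE
    rw [h3, uop_one, one_mul, hp.2.star_eq] at h2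
    exact h2.symm
  have h2 : E * p = 0 := by
    refine hτ.faithful _ ?_
    rw [star_mul, hE, hp.2.star_eq, mul_assoc, ← mul_assoc E, hEE, hτ.tracial, mul_assoc, hp.1.eq,
      hτ.tracial, h1]
  have h3 : p * E = 0 := by
    have := congrArg star h2
    rwa [star_mul, hE, hp.2.star_eq, star_zero] at this
  have h4 : (E : H →L[ℂ] H) v = v := Submodule.starProjection_eq_self_iff.2 ((hN v).2 hv)
  rw [← h4]
  exact congrArg (fun T : M.toStarSubalgebra => (T : H →L[ℂ] H) v) h3

/-- Zorn's lemma for partially isometric intertwiners with orthogonal initial spaces. A nonzero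
intertwiner vanishing on all of these spaces would have a polar part enlarging the family. -/
theorem exists_maximal_intertwiners (hp : IsStarProjection p) :
    ∃ S : Set (H →L[ℂ] EllTwo Γ), (∀ V ∈ S, IsIntertwiner φ p V) ∧ (∀ V ∈ S, V ∘L V† ∘L V = V) ∧
      (∀ V ∈ S, ∀ W ∈ S, V ≠ W → V ∘L W† = 0) ∧
      ∀ C, IsIntertwiner φ p C → (∀ V ∈ S, C ∘L V† = 0) → C = 0 := by
  obtain ⟨S, hS⟩ := zorn_subset {S : Set (H →L[ℂ] EllTwo Γ) | (∀ V ∈ S, IsIntertwiner φ p V) ∧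
      (∀ V ∈ S, V ∘L V† ∘L V = V) ∧ (∀ V ∈ S, ∀ W ∈ S, V ≠ W → V ∘L W† = 0)} (by
    intro c hc hchain
    refine ⟨⋃₀ c, ⟨?_, ?_, ?_⟩, fun s hs => Set.subset_sUnion_of_mem hs⟩
    · rintro V ⟨s, hs, hV⟩
      exact (hc hs).1 V hV
    · rintro V ⟨s, hs, hV⟩
      exact (hc hs).2.1 V hV
    · rintro V ⟨s, hs, hV⟩ W ⟨t, ht, hW⟩ hVW
      rcases hchain.total hs ht with hst | hst
      · exact (hc ht).2.2 V (hst hV) W hW hVW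
      · exact (hc hs).2.2 V hV W (hst hW) hVW)
  obtain ⟨h1, h2, h3⟩ := hS.prop
  refine ⟨S, h1, h2, h3, fun C hC hCS => ?_⟩
  obtain ⟨V, hV, hVV, hker⟩ := hC.exists_polar hp
  have hVS : ∀ W ∈ S, V ∘L W† = 0 := fun W hW => by
    ext1 u
    exact (hker _).1 (congrArg (fun T : EllTwo Γ →L[ℂ] EllTwo Γ => T u) (hCS W hW))
  have hSV : ∀ W ∈ S, W ∘L V† = 0 := fun W hW => by
    have := congrArg adjoint (hVS W hW)
    rwa [adjoint_comp, adjoint_adjoint, map_zero] at this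
  have hins : insert V S ⊆ S := by
    refine hS.le_of_ge ⟨?_, ?_, ?_⟩ (Set.subset_insert V S)
    · rintro W (rfl | hW)
      exacts [hV, h1 W hW]
    · rintro W (rfl | hW)
      exacts [hVV, h2 W hW]
    · rintro W (rfl | hW) W' (rfl | hW') hne
      exacts [absurd rfl hne, hVS W' hW', hSV W hW, h3 W hW W' hW' hne]
  -- Maximality puts `V` in `S`, so `V` is orthogonal to itself.
  have hV0 : V = 0 := by
    rw [← hVV, ← comp_assoc, hVS V (hins (Set.mem_insert V S)), zero_comp]
  ext1 v
  exact (hker v).2 (by rw [hV0, zero_apply])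

theorem IsIntertwiner.sub_comp_adjoint_comp {K : Type*} [NormedAddCommGroup K]
    [InnerProductSpace ℂ K] [CompleteSpace K] {T : H →L[ℂ] K} {A : Γ → K →L[ℂ] K}
    (hA : ∀ g, (A g)† = A g⁻¹) (hTg : ∀ g, T ∘L (uop φ g : H →L[ℂ] H) = A g ∘L T)
    (hTp : T ∘L (p : H →L[ℂ] H) = T) {C : H →L[ℂ] EllTwo Γ} (hC : IsIntertwiner φ p C) :
    IsIntertwiner φ p (C - C ∘L (T† ∘L T)) := by
  have hq : ∀ g, (T† ∘L T) ∘L (uop φ g : H →L[ℂ] H) = (uop φ g : H →L[ℂ] H) ∘L (T† ∘L T) :=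
    fun g => by rw [comp_assoc, hTg, ← comp_assoc, adjoint_comp_of_comp_uop hA hTg, comp_assoc]
  constructor
  · intro g
    rw [sub_comp, comp_sub, hC.comp_uop, comp_assoc, hq, ← comp_assoc, hC.comp_uop, comp_assoc]
  · rw [sub_comp, hC.comp_proj, comp_assoc, comp_assoc, hTp]

set_option maxHeartbeats 1000000 in
/-- The part of `φ` under `p` is a subrepresentation of a multiple of the regular
representation. -/
theorem exists_regular_embedding (hτ : IsFaithfulNormalTrace M τ)
    (hp : IsStarProjection p) (hcomm : ∀ g, Commute p (uop φ g))
    (htr : ∀ g, g ≠ 1 → τ (uop φ g * p) = 0) :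
    ∃ (S : Set (H →L[ℂ] EllTwo Γ)) (T : H →L[ℂ] lp (fun _ : S => EllTwo Γ) 2),
      T† ∘L T = (p : H →L[ℂ] H) ∧ T ∘L (p : H →L[ℂ] H) = T ∧
      (∀ g, T ∘L (uop φ g : H →L[ℂ] H) = amp S (leftRegular g) ∘L T) ∧
      (∀ x : (groupVNA Γ).toStarSubalgebra, (T ∘L T†) ∘L amp S (x : EllTwo Γ →L[ℂ] EllTwo Γ)
        = amp S (x : EllTwo Γ →L[ℂ] EllTwo Γ) ∘L (T ∘L T†)) ∧
      ∀ C, IsIntertwiner φ p C → ∀ x : (groupVNA Γ).toStarSubalgebra,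
        (C ∘L T†) ∘L amp S (x : EllTwo Γ →L[ℂ] EllTwo Γ)
          = (x : EllTwo Γ →L[ℂ] EllTwo Γ) ∘L (C ∘L T†) := by
  classical
  obtain ⟨S, hS, hpi, horth, hmax⟩ := exists_maximal_intertwiners (φ := φ) hp
  have hbessel := sum_norm_sq_le_of_partialIsometry (V := fun V : S => V.1)
    (fun V => hpi V.1 V.2) (fun V W hVW => horth V.1 V.2 W.1 W.2 fun h => hVW (Subtype.ext h))
  have hsum : ∀ v, Summable fun V : S => ‖V.1 v‖ ^ 2 := fun v =>
    summable_of_sum_le (fun V => by positivity) (hbessel v)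
  obtain ⟨T, hTi⟩ : ∃ T : H →L[ℂ] lp (fun _ : S => EllTwo Γ) 2, ∀ v (V : S), T v V = V.1 v :=
    ⟨rowOp (fun V : S => V.1) hsum (fun v => (hsum v).tsum_le_of_sum_le (hbessel v)),
      fun _ _ => rfl⟩
  have hTs : ∀ (V : S) u, (T†) (lp.single 2 V u) = (V.1†) u := fun V u => by
    refine ext_inner_right ℂ fun v => ?_
    rw [adjoint_inner_left, adjoint_inner_left, lp.inner_single_left, hTi]
  have hTp : T ∘L (p : H →L[ℂ] H) = T := by
    ext1 v
    refine lp.ext (funext fun V => ?_)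
    refine (hTi _ V).trans <| Eq.trans ?_ (hTi _ V).symm
    exact congrArg (fun C : H →L[ℂ] EllTwo Γ => C v) (hS V.1 V.2).comp_proj
  have hTg : ∀ g, T ∘L (uop φ g : H →L[ℂ] H) = amp S (leftRegular g) ∘L T := fun g => by
    ext1 v
    refine lp.ext (funext fun V => ?_)
    refine (hTi _ V).trans <| Eq.trans ?_ (congrArg (leftRegular g) (hTi _ V).symm)
    exact congrArg (fun C : H →L[ℂ] EllTwo Γ => C v) ((hS V.1 V.2).comp_uop g)
  have hpT : (p : H →L[ℂ] H) ∘L T† = T† := proj_comp_adjoint_of_comp_proj hp hTp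
  have hx : ∀ C, IsIntertwiner φ p C → ∀ x : (groupVNA Γ).toStarSubalgebra,
      (C ∘L T†) ∘L amp S (x : EllTwo Γ →L[ℂ] EllTwo Γ)
        = (x : EllTwo Γ →L[ℂ] EllTwo Γ) ∘L (C ∘L T†) := by
    intro C hC x
    refine lp.ext_continuousLinearMap (by norm_num) fun V => ?_
    ext1 u
    simp only [comp_apply, lp.singleContinuousLinearMap_apply, amp_single, hTs]
    exact congrArg (fun D : EllTwo Γ →L[ℂ] EllTwo Γ => D u)
      (hC.comp_adjoint_comp (hS V.1 V.2) x)
  -- `T†T` is the identity on each initial space, since the other members of `S` vanish there.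
  have hTV : ∀ V : S, (T† ∘L T) ∘L V.1† = V.1† := by
    intro V
    ext1 u
    have h1 : T ((V.1†) u) = lp.single 2 V (V.1 ((V.1†) u)) := by
      refine lp.ext (funext fun W => ?_)
      rw [hTi]
      by_cases hWV : W = V
      · subst hWV
        simp
      · have := congrArg (fun D : EllTwo Γ →L[ℂ] EllTwo Γ => D u)
          (horth W.1 W.2 V.1 V.2 fun h => hWV (Subtype.ext h))
        rw [lp.single_apply, Pi.single_eq_of_ne hWV]
        exact this
    have h2 := congrArg adjoint (hpi V.1 V.2)
    rw [adjoint_comp, adjoint_comp, adjoint_adjoint] at h2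
    change (T†) (T ((V.1†) u)) = _
    rw [h1, hTs]
    exact congrArg (fun D : EllTwo Γ →L[ℂ] H => D u) h2
  -- `C - C T†T` is an intertwiner killing every initial space, so it vanishes by maximality. As
  -- intertwiners separate the points of `pH`, this yields `T†T = p`.
  have hCT : ∀ C, IsIntertwiner φ p C → C ∘L (T† ∘L T) = C := by
    intro C hC
    have h1 : IsIntertwiner φ p (C - C ∘L (T† ∘L T)) :=
      hC.sub_comp_adjoint_comp (A := fun g => amp S (leftRegular g))
        (fun g => by rw [adjoint_amp, adjoint_leftRegular]) hTg hTp
    refine (sub_eq_zero.1 (hmax _ h1 fun V hV => ?_)).symm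
    rw [sub_comp, comp_assoc, hTV ⟨V, hV⟩, sub_self]
  refine ⟨S, T, ?_, hTp, hTg, fun x => ?_, hx⟩
  · ext1 v
    have h1 := apply_eq_zero_of_forall_isIntertwiner hτ hp hcomm htr
      (v := v - (T†) (T v)) fun C hC => by
        rw [map_sub, sub_eq_zero]
        exact (congrArg (fun D : H →L[ℂ] EllTwo Γ => D v) (hCT C hC)).symm
    rw [map_sub, sub_eq_zero] at h1
    exact (h1.trans
      (congrArg (fun D : lp (fun _ : S => EllTwo Γ) 2 →L[ℂ] H => D (T v)) hpT)).symm
  · ext1 w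
    refine lp.ext (funext fun V => ?_)
    simp only [comp_apply, amp_apply, hTi]
    exact congrArg (fun D : lp (fun _ : S => EllTwo Γ) 2 →L[ℂ] EllTwo Γ => D w)
      (hx V.1 (hS V.1 V.2) x)

end Decomposition

open ContinuousLinearMap InnerProduct

/-! ### Homomorphisms obtained by compression. -/

section Homomorphism

/-- The compression of a representation to a reducing subspace. -/
def compressionHom {A : Type*} [NonUnitalRing A] [StarRing A] [Module ℂ A]
    {L : Type*} [NormedAddCommGroup L] [InnerProductSpace ℂ L] [CompleteSpace L]
    {H : Type*} [NormedAddCommGroup H] [InnerProductSpace ℂ H] [CompleteSpace H]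
    (M : VonNeumannAlgebra H) (π : A →⋆ₙₐ[ℂ] (L →L[ℂ] L)) (T : H →L[ℂ] L)
    (hT : T ∘L (T† ∘L T) = T) (hx : ∀ x, (T ∘L T†) ∘L π x = π x ∘L (T ∘L T†))
    (hM : ∀ x, T† ∘L (π x ∘L T) ∈ M.toStarSubalgebra) : A →⋆ₙₐ[ℂ] M.toStarSubalgebra where
  toFun x := ⟨T† ∘L (π x ∘L T), hM x⟩
  map_smul' c x := by
    refine Subtype.ext ?_
    change T† ∘L (π (c • x) ∘L T) = c • (T† ∘L (π x ∘L T))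
    rw [map_smul, smul_comp, comp_smul]
  map_zero' := by
    refine Subtype.ext ?_
    change T† ∘L (π 0 ∘L T) = 0
    rw [map_zero, zero_comp, comp_zero]
  map_add' x y := by
    refine Subtype.ext ?_
    change T† ∘L (π (x + y) ∘L T) = T† ∘L (π x ∘L T) + T† ∘L (π y ∘L T)
    rw [map_add, add_comp, comp_add]
  map_mul' x y := by
    refine Subtype.ext ?_
    change T† ∘L (π (x * y) ∘L T) = (T† ∘L (π x ∘L T)) ∘L (T† ∘L (π y ∘L T))
    have h : T ∘L (T† ∘L (π y ∘L T)) = π y ∘L T := by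
      rw [← comp_assoc, ← comp_assoc, hx, comp_assoc, comp_assoc, hT]
    rw [map_mul, comp_assoc, comp_assoc, h]
    rfl
  map_star' x := by
    refine Subtype.ext ?_
    change T† ∘L (π (star x) ∘L T) = (T† ∘L (π x ∘L T))†
    rw [adjoint_comp, adjoint_comp, adjoint_adjoint, map_star, comp_assoc, star_eq_adjoint]

variable {K : Type*} [NormedAddCommGroup K] [InnerProductSpace ℂ K] [CompleteSpace K]

/-- The amplification of the identity representation of a von Neumann algebra. -/
def ampHom (N : VonNeumannAlgebra K) (ι : Type*) :
    N.toStarSubalgebra →⋆ₙₐ[ℂ] (lp (fun _ : ι => K) 2 →L[ℂ] lp (fun _ : ι => K) 2) where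
  toFun x := amp ι (x : K →L[ℂ] K)
  map_smul' c x := amp_smul c (x : K →L[ℂ] K)
  map_zero' := rfl
  map_add' x y := amp_add (x : K →L[ℂ] K) y
  map_mul' x y := amp_mul (x : K →L[ℂ] K) y
  map_star' x := (adjoint_amp (x : K →L[ℂ] K)).symm

end Homomorphism

/-! ### The canonical trace of `L(Γ)`. -/

section GroupTrace

variable {Γ : Type*} [Group Γ]

open Classical in
theorem groupTrace_eq_apply (x : (groupVNA Γ).toStarSubalgebra) :
    groupTrace x = (x : EllTwo Γ →L[ℂ] EllTwo Γ) (lp.single 2 (1 : Γ) (1 : ℂ)) 1 := by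
  rw [groupTrace, lp.inner_single_left]
  simp

open Classical in
/-- The canonical trace of a group von Neumann algebra is faithful on each `x λ(g)`. -/
theorem eq_zero_of_groupTrace {x : (groupVNA Γ).toStarSubalgebra}
    (h : ∀ g, groupTrace (star (x * lam g) * (x * lam g)) = 0) : x = 0 := by
  refine Subtype.ext ?_
  refine lp.ext_continuousLinearMap (by norm_num) fun g => ?_
  ext1
  have h1 : ⟪(x : EllTwo Γ →L[ℂ] EllTwo Γ) (leftRegular g (lp.single 2 (1 : Γ) (1 : ℂ))),
      (x : EllTwo Γ →L[ℂ] EllTwo Γ) (leftRegular g (lp.single 2 (1 : Γ) (1 : ℂ)))⟫_ℂ = 0 :=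
    (adjoint_inner_right ((x : EllTwo Γ →L[ℂ] EllTwo Γ) ∘L leftRegular g) _ _).symm.trans (h g)
  rw [inner_self_eq_zero, leftRegular_single, mul_one] at h1
  exact h1

end GroupTrace

/-! ### Extension to the group von Neumann algebra. -/

section Main

variable {H : Type*} [NormedAddCommGroup H] [InnerProductSpace ℂ H] [CompleteSpace H]
  {M : VonNeumannAlgebra H} {τ : M.toStarSubalgebra →ₗ[ℂ] ℂ}
  {Γ : Type*} [Group Γ] {φ : Γ →* unitary M.toStarSubalgebra} {p : M.toStarSubalgebra}

open Classical in
/-- If `ψ(x)` is intertwined with `x` by all intertwiners, then `ψ` scales the trace. -/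
theorem trace_eq_of_isIntertwiner (hτ : IsFaithfulNormalTrace M τ)
    (hp : IsStarProjection p) (hcomm : ∀ g, Commute p (uop φ g))
    (htr : ∀ g, g ≠ 1 → τ (uop φ g * p) = 0) {x : (groupVNA Γ).toStarSubalgebra}
    {y : M.toStarSubalgebra} (hy : p * y = y)
    (h : ∀ C : H →L[ℂ] EllTwo Γ, IsIntertwiner φ p C →
      C ∘L (y : H →L[ℂ] H) = (x : EllTwo Γ →L[ℂ] EllTwo Γ) ∘L C) :
    τ y = τ p * groupTrace x := by
  obtain ⟨θ, B, hB, hBg, hBp⟩ := exists_coefficientOperator hτ hp hcomm htr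
  have hBy : B ∘L amp ℕ (y : H →L[ℂ] H) = (x : EllTwo Γ →L[ℂ] EllTwo Γ) ∘L B := by
    refine lp.ext_continuousLinearMap (by norm_num) fun n => ?_
    ext1 v
    have := congrArg (fun D : H →L[ℂ] EllTwo Γ => D v) (h _ (isIntertwiner_comp_single hBg hBp n))
    simp only [comp_apply, lp.singleContinuousLinearMap_apply, amp_single] at this ⊢
    exact this
  -- The coordinates of `B θ` are the coefficients `τ(φ(g⁻¹)p)`, which vanish off the identity.
  -- Comparing the coordinates of `B(yθ) = xBθ` at the identity then gives the trace formula.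
  have h1 : B θ = τ p • lp.single 2 (1 : Γ) (1 : ℂ) := by
    refine lp.ext (funext fun g => ?_)
    have h2 := hB 1 g
    rw [mul_one] at h2
    refine h2.trans ?_
    rw [lp.coeFn_smul, Pi.smul_apply, lp.single_apply]
    by_cases hg : g = 1
    · subst hg
      rw [Pi.single_eq_same, uop_one, one_mul, hp.2.star_eq, smul_eq_mul, mul_one]
    · rw [Pi.single_eq_of_ne hg, smul_zero, star_mul, hp.2.star_eq, ← uop_inv, hτ.tracial]
      exact htr _ (inv_ne_one.2 hg)
  have h3 := hB y 1
  have h4 : B (amp ℕ (y : H →L[ℂ] H) θ) = (x : EllTwo Γ →L[ℂ] EllTwo Γ) (B θ) :=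
    congrArg (fun D : lp (fun _ : ℕ => H) 2 →L[ℂ] EllTwo Γ => D θ) hBy
  rw [h4, h1, map_smul, uop_one, one_mul, hp.2.star_eq, hy, lp.coeFn_smul, Pi.smul_apply,
    ← groupTrace_eq_apply, smul_eq_mul] at h3
  exact h3.symm

set_option maxHeartbeats 1000000 in
/-- A representation in a finite von Neumann algebra whose character under `p` is a multiple of
the regular character extends to the group von Neumann algebra. -/
theorem exists_normal_hom (hτ : IsFaithfulNormalTrace M τ)
    (hp : IsStarProjection p) (hcomm : ∀ g, Commute p (uop φ g))
    (htr : ∀ g, g ≠ 1 → τ (uop φ g * p) = 0) :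
    ∃ ψ : (groupVNA Γ).toStarSubalgebra →⋆ₙₐ[ℂ] M.toStarSubalgebra,
      (∀ x, ψ x ∈ corner M p) ∧ ψ 1 = p ∧ IsNormalMap _ M ψ ∧
      (∀ x, τ (ψ x) = τ p * groupTrace x) ∧ (p ≠ 0 → Function.Injective ψ) ∧
      ∀ g, ψ (lam g) = uop φ g * p := by
  obtain ⟨S, T, hTT, hTp, hTg, hx, hC⟩ := exists_regular_embedding hτ hp hcomm htr
  have hpT : (p : H →L[ℂ] H) ∘L T† = T† := proj_comp_adjoint_of_comp_proj hp hTp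
  have hpT' : ∀ w, (p : H →L[ℂ] H) ((T†) w) = (T†) w := fun w =>
    congrArg (fun D : lp (fun _ : S => EllTwo Γ) 2 →L[ℂ] H => D w) hpT
  have hTT' : ∀ v, (T†) (T v) = (p : H →L[ℂ] H) v := fun v =>
    congrArg (fun D : H →L[ℂ] H => D v) hTT
  have hTp' : ∀ v, T ((p : H →L[ℂ] H) v) = T v := fun v =>
    congrArg (fun D : H →L[ℂ] lp (fun _ : S => EllTwo Γ) 2 => D v) hTp
  have hCψ : ∀ C, IsIntertwiner φ p C → ∀ (x : (groupVNA Γ).toStarSubalgebra) (v : H),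
      C ((T†) (amp S (x : EllTwo Γ →L[ℂ] EllTwo Γ) (T v)))
        = (x : EllTwo Γ →L[ℂ] EllTwo Γ) (C v) := by
    intro C hCi x v
    have h1 := congrArg (fun D : lp (fun _ : S => EllTwo Γ) 2 →L[ℂ] EllTwo Γ => D (T v))
      (hC C hCi x)
    refine h1.trans (congrArg (x : EllTwo Γ →L[ℂ] EllTwo Γ) ?_)
    change C ((T†) (T v)) = C v
    rw [hTT']
    exact congrArg (fun D : H →L[ℂ] EllTwo Γ => D v) hCi.comp_proj
  -- For `y ∈ M'`, both `C` and `C ∘ y` are intertwiners, so `C` takes `yψ(x)v` and `ψ(x)yv` to the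
  -- same vector `xCyv`. Separation of points and the bicommutant theorem put `ψ(x)` in `M`.
  have hM : ∀ x : (groupVNA Γ).toStarSubalgebra,
      T† ∘L (amp S (x : EllTwo Γ →L[ℂ] EllTwo Γ) ∘L T) ∈ M.toStarSubalgebra := by
    intro x
    refine mem_of_commute_commutant fun y hy => ContinuousLinearMap.ext fun v => ?_
    have h1 := apply_eq_zero_of_forall_isIntertwiner hτ hp hcomm htr
      (v := y ((T†) (amp S (x : EllTwo Γ →L[ℂ] EllTwo Γ) (T v)))
        - (T†) (amp S (x : EllTwo Γ →L[ℂ] EllTwo Γ) (T (y v)))) fun C hCi => by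
        rw [map_sub, hCψ C hCi, sub_eq_zero]
        exact hCψ _ (hCi.comp_commutant hy) x v
    rw [map_sub, hpT', commutant_apply hy, hpT', sub_eq_zero] at h1
    exact h1
  obtain ⟨ψ, hψ'⟩ : ∃ ψ : (groupVNA Γ).toStarSubalgebra →⋆ₙₐ[ℂ] M.toStarSubalgebra,
      ∀ x, (ψ x : H →L[ℂ] H) = T† ∘L (amp S (x : EllTwo Γ →L[ℂ] EllTwo Γ) ∘L T) :=
    ⟨compressionHom M (ampHom (groupVNA Γ) S) T (by rw [hTT, hTp]) hx hM, fun _ => rfl⟩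
  have hψ : ∀ x v, (ψ x : H →L[ℂ] H) v
      = (T†) (amp S (x : EllTwo Γ →L[ℂ] EllTwo Γ) (T v)) := fun x v =>
    congrArg (fun D : H →L[ℂ] H => D v) (hψ' x)
  have hpψ : ∀ x, p * ψ x = ψ x := fun x =>
    Subtype.ext (ContinuousLinearMap.ext fun v => by
      change (p : H →L[ℂ] H) ((ψ x : H →L[ℂ] H) v) = (ψ x : H →L[ℂ] H) v
      rw [hψ, hpT'])
  have hψp : ∀ x, ψ x * p = ψ x := fun x =>
    Subtype.ext (ContinuousLinearMap.ext fun v => by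
      change (ψ x : H →L[ℂ] H) ((p : H →L[ℂ] H) v) = (ψ x : H →L[ℂ] H) v
      rw [hψ, hψ, hTp'])
  have htrace : ∀ x, τ (ψ x) = τ p * groupTrace x := fun x =>
    trace_eq_of_isIntertwiner hτ hp hcomm htr (hpψ x) fun C hCi =>
      ContinuousLinearMap.ext fun v => (congrArg C (hψ x v)).trans (hCψ C hCi x v)
  refine ⟨ψ, fun x => ⟨ψ x, by rw [hpψ, hψp]⟩, ?_, ?_, htrace, fun hp0 => ?_, fun g => ?_⟩
  · exact Subtype.ext (ContinuousLinearMap.ext fun v => (hψ 1 v).trans (hTT' v))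
  · exact isNormalMap_of_eq_amp T hψ'
  -- Since `τ p ≠ 0`, the trace formula makes `‖x δ_g‖²` vanish for every `g` when `ψ x = 0`.
  · have hτp : τ p ≠ 0 := fun h0 => hp0 (hτ.faithful p (by rw [hp.2.star_eq, hp.1.eq, h0]))
    refine (injective_iff_map_eq_zero ψ).2 fun x hx0 => eq_zero_of_groupTrace fun g => ?_
    have h0 : ψ (x * lam g) = 0 := by rw [map_mul ψ, hx0, zero_mul]
    have h1 := htrace (star (x * lam g) * (x * lam g))
    rw [map_mul ψ, h0, mul_zero, map_zero] at h1
    exact (mul_eq_zero.1 h1.symm).resolve_left hτp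
  · refine Eq.trans (Subtype.ext (ContinuousLinearMap.ext fun v => ?_)) (hcomm g).eq
    refine (hψ (lam g) v).trans (Eq.trans ?_ (hTT' ((uop φ g : H →L[ℂ] H) v)))
    exact congrArg (T†)
      (congrArg (fun D : H →L[ℂ] lp (fun _ : S => EllTwo Γ) 2 => D v) (hTg g)).symm

end Main

/-! ### Passage to `PSLₙ(k)`. -/

section ProjectiveSpecialLinearGroup

variable {H : Type*} [NormedAddCommGroup H] [InnerProductSpace ℂ H] [CompleteSpace H]
  {M : VonNeumannAlgebra H} {τ : M.toStarSubalgebra →ₗ[ℂ] ℂ}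
  {n k : Type*} [Fintype n] [DecidableEq n] [Nontrivial n] [Field k] [Infinite k]

/-- The character of a representation of `PSLₙ(k)` is constant away from the identity. -/
theorem trace_eq_of_ne_one
    (φ : Matrix.ProjectiveSpecialLinearGroup n k →* unitary M.toStarSubalgebra)
    (hτ : IsFaithfulNormalTrace M τ) {g : Matrix.ProjectiveSpecialLinearGroup n k} (hg : g ≠ 1) :
    τ (uop φ g) = τ (fixP φ) := by
  obtain ⟨g, rfl⟩ := QuotientGroup.mk'_surjective
    (Subgroup.center (Matrix.SpecialLinearGroup n k)) g
  have hg' : g ∉ Subgroup.center (Matrix.SpecialLinearGroup n k) := fun h =>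
    hg ((QuotientGroup.eq_one_iff g).2 h)
  have h1 := trace_eq_of_notMem_center
    (φ.comp (QuotientGroup.mk' (Subgroup.center (Matrix.SpecialLinearGroup n k)))) hτ hg'
  have h2 : fixP (φ.comp (QuotientGroup.mk' (Subgroup.center (Matrix.SpecialLinearGroup n k))))
      = fixP φ := by
    refine fixP_congr (fun x => ⟨QuotientGroup.mk' _ x, rfl⟩) fun x => ?_
    obtain ⟨y, rfl⟩ := QuotientGroup.mk'_surjective
      (Subgroup.center (Matrix.SpecialLinearGroup n k)) x
    exact ⟨y, rfl⟩
  rw [h2] at h1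
  exact h1

end ProjectiveSpecialLinearGroup

end VNRigidity

end

theorem mainTheorem7 {H : Type*} [NormedAddCommGroup H] [InnerProductSpace ℂ H] [CompleteSpace H]
    (M : VonNeumannAlgebra H) (τ : M.toStarSubalgebra →ₗ[ℂ] ℂ)
    (hτ : VNRigidity.IsFaithfulNormalTrace M τ)
    (m : ℕ) (hm : 2 ≤ m) {k : Type*} [Field k] [Infinite k]
    (φ : Matrix.ProjectiveSpecialLinearGroup (Fin m) k →* unitary M.toStarSubalgebra) :
    ∃ p : M.toStarSubalgebra, IsStarProjection p ∧
      (∀ g, Commute p (φ g : M.toStarSubalgebra)) ∧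
      ∃ ψ : (VNRigidity.groupVNA (Matrix.ProjectiveSpecialLinearGroup (Fin m) k)).toStarSubalgebra
          →⋆ₙₐ[ℂ] M.toStarSubalgebra,
        (∀ x, ψ x ∈ VNRigidity.corner M p) ∧
        ψ 1 = p ∧
        VNRigidity.IsNormalMap _ M ψ ∧
        (∀ x, τ (ψ x) = τ p * VNRigidity.groupTrace x) ∧
        (p ≠ 0 → Function.Injective ψ) ∧
        ∀ g, (φ g : M.toStarSubalgebra) = ψ (VNRigidity.lam g) + (1 - p) := by
  open VNRigidity in
  have : Nontrivial (Fin m) := Fin.nontrivial_iff_two_le.2 hm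
  -- Removing the fixed vectors subtracts exactly the constant value `τ(fixP φ)` of the character
  -- off the identity.
  have hp : IsStarProjection (1 - fixP φ) := (isStarProjection_fixP φ).one_sub
  have hcomm : ∀ g, Commute (1 - fixP φ) (uop φ g) := fun g =>
    (Commute.one_left _).sub_left ((fixP_mul_uop φ g).trans (uop_mul_fixP φ g).symm)
  obtain ⟨ψ, hcorner, hone, hnormal, htrace, hinj, hlam⟩ :=
    exists_normal_hom hτ hp hcomm fun g hg => by
      rw [mul_sub, mul_one, uop_mul_fixP, map_sub, trace_eq_of_ne_one φ hτ hg, sub_self]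
  refine ⟨1 - fixP φ, hp, hcomm, ψ, hcorner, hone, hnormal, htrace, hinj, fun g => ?_⟩
  rw [hlam, mul_sub, mul_one, uop_mul_fixP, sub_sub_cancel, sub_add_cancel]
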